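/- Let $(M,g)$ be a smooth Lorentzian manifold of dimension $d\ge 4$ (signature $(-,+,\dots,+)$) which is Einstein, $R_{\mu\nu}=\Lambda g_{\mu\nu}$ with $\Lambda\in\mathbb{R}$ constant, and let $\ell$ be a smooth null vector field on $M$. A null frame at $p\in M$ containing $\ell$ is a basis $(\ell,n,m_2,\dots,m_{d-1})$ of $T_pM$ whose only non-vanishing scalar products are $\ell\cdot n=1$ and $m_i\cdot m_j=\delta_{ij}$; a lowered index $0$, $1$ or $i$ denotes contraction with $\ell$, $n$ or $m_i$. In such a frame put $$\kappa_i=m_i^\mu\ell^\nu\nabla_\nu\ell_\mu,\qquad \rho_{ij}=m_i^\mu m_j^\nu\nabla_\nu\ell_\mu,\qquad \rho=\rho_{ii}.$$ Assume that $\ell$ is a multiple WAND of type N alignment: at every point, in a null frame containing $\ell$, all components of the Weyl tensor $C$ except $C_{1i1j}$ (that is, all those of boost weight $2,1,0,-1$) vanish. Let $S\subseteq M$ be the support of the Weyl tensor, i.e. the closure of $\{p\in M: C(p)\neq 0\}$; thus $S=M$ if, for instance, $C$ vanishes nowhere. 1. At every $p\in S$ and for every null frame at $p$ containing $\ell$ there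 is a rotation $m_i\mapsto X_{ij}m_j$, $X\in SO(d-2)$, after which the symmetric part of the optical matrix is diagonal and $$(\rho_{ij})=\left(\begin{array}{c|c}\tfrac12\begin{pmatrix}\rho & a\\ -a&\rho\end{pmatrix}&0\\ \hline 0&0\end{array}\right)$$ for some $a\in\mathbb{R}$. 2. If $\rho=0$ at every point of $U\cap S$, where $U\subseteq M$ is open, then $a=0$ there; indeed at every point of $U\cap S$ and in every null frame containing $\ell$ one has $\kappa_i=0$ and $\rho_{ij}=0$. In particular, if $S=M$ and $\rho=0$ everywhere, then $\ell$ is geodesic with vanishing optical matrix, i.e. the spacetime is Kundt. -/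

import Mathlib

open scoped Manifold ContDiff

/-! ## Curvature of a metric in coordinates

`G : E → E →L[ℝ] E →L[ℝ] ℝ` is the coordinate expression `g_{μν}(x)` of a (pseudo-Riemannian) metric
on a region of `E = ℝ^d`; vectors of `E` are contracted into the tensor slots. -/

namespace CoordMetric

variable {d : ℕ}

/-- The Christoffel symbols `Γ^μ_{αβ}(x) u^α v^β`: the index of
`½ (∂_u g(v, ·) + ∂_v g(u, ·) - ∂_· g(u, v))` is raised with the inverse metric. -/
noncomputable def christoffel
    (G : EuclideanSpace ℝ (Fin d) →
      EuclideanSpace ℝ (Fin d) →L[ℝ] EuclideanSpace ℝ (Fin d) →L[ℝ] ℝ)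
    (x u v : EuclideanSpace ℝ (Fin d)) : EuclideanSpace ℝ (Fin d) :=
  (G x).inverse
    ((1 / 2 : ℝ) • (fderiv ℝ G x u v + fderiv ℝ G x v u - ((fderiv ℝ G x).flip u).flip v))

/-- The covariant derivative `u^ν ∇_ν X^μ` at `x` of the vector field with components `X`. -/
noncomputable def covDeriv
    (G : EuclideanSpace ℝ (Fin d) →
      EuclideanSpace ℝ (Fin d) →L[ℝ] EuclideanSpace ℝ (Fin d) →L[ℝ] ℝ)
    (X : EuclideanSpace ℝ (Fin d) → EuclideanSpace ℝ (Fin d))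
    (x u : EuclideanSpace ℝ (Fin d)) : EuclideanSpace ℝ (Fin d) :=
  fderiv ℝ X x u + christoffel G x u (X x)

/-- The curvature operator `R(u, v) w = ∇_u ∇_v w - ∇_v ∇_u w`, for coordinate-constant fields
`u`, `v`, `w`. -/
noncomputable def curvature
    (G : EuclideanSpace ℝ (Fin d) →
      EuclideanSpace ℝ (Fin d) →L[ℝ] EuclideanSpace ℝ (Fin d) →L[ℝ] ℝ)
    (x u v w : EuclideanSpace ℝ (Fin d)) : EuclideanSpace ℝ (Fin d) :=
  fderiv ℝ (fun y => christoffel G y v w) x u - fderiv ℝ (fun y => christoffel G y u w) x v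
    + christoffel G x u (christoffel G x v w) - christoffel G x v (christoffel G x u w)

/-- The Riemann tensor with all indices down, `R_{μνρσ} a^μ b^ν c^ρ d^σ = g(R(c, d) b, a)`. -/
noncomputable def riemann
    (G : EuclideanSpace ℝ (Fin d) →
      EuclideanSpace ℝ (Fin d) →L[ℝ] EuclideanSpace ℝ (Fin d) →L[ℝ] ℝ)
    (x a b c e : EuclideanSpace ℝ (Fin d)) : ℝ :=
  G x (curvature G x c e b) a

/-- The Ricci tensor `R_{μν} = R^α_{μαν}`: the trace of `u ↦ R(u, v) w`. -/
noncomputable def ricci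
    (G : EuclideanSpace ℝ (Fin d) →
      EuclideanSpace ℝ (Fin d) →L[ℝ] EuclideanSpace ℝ (Fin d) →L[ℝ] ℝ)
    (x v w : EuclideanSpace ℝ (Fin d)) : ℝ :=
  ∑ i : Fin d, (curvature G x (EuclideanSpace.single i 1) v w) i

/-- The Ricci scalar `R = g^{μν} R_{μν}`; the vector `g^{i ν} ∂_ν` is obtained by raising the index
of the `i`-th coordinate covector. -/
noncomputable def scalar
    (G : EuclideanSpace ℝ (Fin d) →
      EuclideanSpace ℝ (Fin d) →L[ℝ] EuclideanSpace ℝ (Fin d) →L[ℝ] ℝ)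
    (x : EuclideanSpace ℝ (Fin d)) : ℝ :=
  ∑ i : Fin d, ricci G x (EuclideanSpace.single i 1)
    ((G x).inverse (EuclideanSpace.proj i : EuclideanSpace ℝ (Fin d) →L[ℝ] ℝ))

/-- The Weyl tensor: `R_{abcd} = C_{abcd} + 2/(d-2) (g_{a[c} R_{d]b} - g_{b[c} R_{d]a})
- 2R/((d-1)(d-2)) g_{a[c} g_{d]b}`, solved for `C`. -/
noncomputable def weyl
    (G : EuclideanSpace ℝ (Fin d) →
      EuclideanSpace ℝ (Fin d) →L[ℝ] EuclideanSpace ℝ (Fin d) →L[ℝ] ℝ)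
    (x a b c e : EuclideanSpace ℝ (Fin d)) : ℝ :=
  riemann G x a b c e
    - 1 / ((d : ℝ) - 2) *
      (G x a c * ricci G x e b - G x a e * ricci G x c b
        - G x b c * ricci G x e a + G x b e * ricci G x c a)
    + scalar G x / (((d : ℝ) - 1) * ((d : ℝ) - 2)) * (G x a c * G x e b - G x a e * G x c b)

end CoordMetric

/-! ## Spacetimes -/

/-- A smooth Lorentzian metric, of signature `(-, +, …, +)`, on the `d`-dimensional manifold `M`. -/
structure LorentzianMetric (d : ℕ) (M : Type*) [TopologicalSpace M]
    [ChartedSpace (EuclideanSpace ℝ (Fin d)) M] [IsManifold (𝓡 d) ∞ M] where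
  /-- the scalar product on each tangent space -/
  val : ∀ p : M, TangentSpace (𝓡 d) p →L[ℝ] TangentSpace (𝓡 d) p →L[ℝ] ℝ
  symm : ∀ (p : M) (u v : TangentSpace (𝓡 d) p), val p u v = val p v u
  signature : ∀ p : M, ∃ b : Module.Basis (Fin d) ℝ (TangentSpace (𝓡 d) p),
    ∀ i j, val p (b i) (b j) = if i = j then (if (i : ℕ) = 0 then -1 else 1) else 0
  smooth : ContMDiff (𝓡 d)
    ((𝓡 d).prod 𝓘(ℝ, EuclideanSpace ℝ (Fin d) →L[ℝ] EuclideanSpace ℝ (Fin d) →L[ℝ] ℝ)) ∞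
    (fun p => Bundle.TotalSpace.mk'
      (EuclideanSpace ℝ (Fin d) →L[ℝ] EuclideanSpace ℝ (Fin d) →L[ℝ] ℝ) p (val p))

/-- `(ℓ, n, m_i)` is a null frame of the `d`-dimensional space `V` with scalar product `B`: the only
non-vanishing scalar products are `ℓ · n = 1` and `m_i · m_j = δ_ij`. The `d - 2` spatial indices,
written `2, …, d - 1` in the physics literature, are `0, …, d - 3` here. -/
structure IsNullFrame {V : Type*} [AddCommGroup V] [Module ℝ V] [TopologicalSpace V]
    {d : ℕ} (B : V →L[ℝ] V →L[ℝ] ℝ) (ℓ n : V) (m : Fin (d - 2) → V) : Prop where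
  ell_ell : B ℓ ℓ = 0
  n_n : B n n = 0
  ell_n : B ℓ n = 1
  ell_m : ∀ i, B ℓ (m i) = 0
  n_m : ∀ i, B n (m i) = 0
  m_m : ∀ i j, B (m i) (m j) = if i = j then 1 else 0

namespace LorentzianMetric

variable {d : ℕ} {M : Type*} [TopologicalSpace M] [ChartedSpace (EuclideanSpace ℝ (Fin d)) M]
  [IsManifold (𝓡 d) ∞ M]

/-- The coordinate expression of the metric in the chart `e`. -/
noncomputable def coord (g : LorentzianMetric d M)
    (e : OpenPartialHomeomorph M (EuclideanSpace ℝ (Fin d))) (x : EuclideanSpace ℝ (Fin d)) :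
    EuclideanSpace ℝ (Fin d) →L[ℝ] EuclideanSpace ℝ (Fin d) →L[ℝ] ℝ :=
  let A : EuclideanSpace ℝ (Fin d) →L[ℝ] TangentSpace (𝓡 d) (e.symm x) :=
    mfderiv (𝓡 d) (𝓡 d) e.symm x
  (ContinuousLinearMap.precomp ℝ A).comp ((g.val (e.symm x)).comp A)

/-- The components in the chart `e` of a tangent vector at `p`. -/
noncomputable def comps (e : OpenPartialHomeomorph M (EuclideanSpace ℝ (Fin d))) (p : M)
    (v : TangentSpace (𝓡 d) p) : EuclideanSpace ℝ (Fin d) :=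
  mfderiv (𝓡 d) (𝓡 d) e p v

/-- The components in the chart `e` of the covariant derivative `∇_v X` at `p` of a vector field
`X`. -/
noncomputable def covDeriv (g : LorentzianMetric d M)
    (e : OpenPartialHomeomorph M (EuclideanSpace ℝ (Fin d)))
    (X : ∀ p : M, TangentSpace (𝓡 d) p) (p : M) (v : TangentSpace (𝓡 d) p) :
    EuclideanSpace ℝ (Fin d) :=
  CoordMetric.covDeriv (g.coord e) (fun x => comps e (e.symm x) (X (e.symm x))) (e p) (comps e p v)

/-- The Ricci tensor at `p`, computed in the chart `e`. -/
noncomputable def ricci (g : LorentzianMetric d M)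
    (e : OpenPartialHomeomorph M (EuclideanSpace ℝ (Fin d))) (p : M)
    (u v : TangentSpace (𝓡 d) p) : ℝ :=
  CoordMetric.ricci (g.coord e) (e p) (comps e p u) (comps e p v)

/-- The Weyl tensor at `p`, computed in the chart `e`. -/
noncomputable def weyl (g : LorentzianMetric d M)
    (e : OpenPartialHomeomorph M (EuclideanSpace ℝ (Fin d))) (p : M)
    (a b c f : TangentSpace (𝓡 d) p) : ℝ :=
  CoordMetric.weyl (g.coord e) (e p) (comps e p a) (comps e p b) (comps e p c) (comps e p f)

/-- Einstein spacetimes: `R_{μν} = Λ g_{μν}`, in every chart of the smooth structure. -/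
def IsEinstein (g : LorentzianMetric d M) (Λ : ℝ) : Prop :=
  ∀ e ∈ IsManifold.maximalAtlas (𝓡 d) ∞ M, ∀ p ∈ e.source, ∀ u v : TangentSpace (𝓡 d) p,
    g.ricci e p u v = Λ * g.val p u v

/-- All components of the Weyl tensor at `p` of boost weights `2, 1, 0, -1` in the frame
`(ℓ, n, m_i)` vanish; only `C_{1i1j}`, of boost weight `-2`, remains. Frame index `0` stands for
contraction with `ℓ`, and `1` for contraction with `n`. -/
structure WeylTypeNInFrame (g : LorentzianMetric d M)
    (e : OpenPartialHomeomorph M (EuclideanSpace ℝ (Fin d))) (p : M)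
    (ℓ n : TangentSpace (𝓡 d) p) (m : Fin (d - 2) → TangentSpace (𝓡 d) p) : Prop where
  /-- boost weight `2` -/
  C0i0j : ∀ i j, g.weyl e p ℓ (m i) ℓ (m j) = 0
  /-- boost weight `1` -/
  C0ijk : ∀ i j k, g.weyl e p ℓ (m i) (m j) (m k) = 0
  C010i : ∀ i, g.weyl e p ℓ n ℓ (m i) = 0
  /-- boost weight `0` -/
  Cijkl : ∀ i j k l, g.weyl e p (m i) (m j) (m k) (m l) = 0
  C0i1j : ∀ i j, g.weyl e p ℓ (m i) n (m j) = 0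
  C01ij : ∀ i j, g.weyl e p ℓ n (m i) (m j) = 0
  C0101 : g.weyl e p ℓ n ℓ n = 0
  /-- boost weight `-1` -/
  C1ijk : ∀ i j k, g.weyl e p n (m i) (m j) (m k) = 0
  C101i : ∀ i, g.weyl e p n ℓ n (m i) = 0

/-- `ℓ` is a multiple WAND of type N alignment: at every point of the spacetime, in a null frame
containing `ℓ`, all Weyl components of boost weights `2, 1, 0, -1` vanish. -/
def IsTypeNWAND (g : LorentzianMetric d M) (ℓ : ∀ p : M, TangentSpace (𝓡 d) p) : Prop :=
  ∀ e ∈ IsManifold.maximalAtlas (𝓡 d) ∞ M, ∀ p ∈ e.source,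
    ∃ (n : TangentSpace (𝓡 d) p) (m : Fin (d - 2) → TangentSpace (𝓡 d) p),
      IsNullFrame (g.val p) (ℓ p) n m ∧ g.WeylTypeNInFrame e p (ℓ p) n m

/-- The part in the domain of the chart `e` of the support of the Weyl tensor, that is, of the
closure of the set of points at which the Weyl tensor is not zero. -/
def weylSupport (g : LorentzianMetric d M)
    (e : OpenPartialHomeomorph M (EuclideanSpace ℝ (Fin d))) : Set M :=
  e.source ∩ closure {p | p ∈ e.source ∧ ∃ a b c f, g.weyl e p a b c f ≠ 0}

/-- `κ_i = m_i^μ ℓ^ν ∇_ν ℓ_μ`, computed in the chart `e`; `ℓ` is geodesic iff `κ = 0`. -/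
noncomputable def kappa (g : LorentzianMetric d M)
    (e : OpenPartialHomeomorph M (EuclideanSpace ℝ (Fin d)))
    (ℓ : ∀ p : M, TangentSpace (𝓡 d) p) (p : M)
    (m : Fin (d - 2) → TangentSpace (𝓡 d) p) (i : Fin (d - 2)) : ℝ :=
  g.coord e (e p) (comps e p (m i)) (g.covDeriv e ℓ p (ℓ p))

/-- The optical matrix `ρ_ij = m_i^μ m_j^ν ∇_ν ℓ_μ` of `ℓ` at `p`, computed in the chart `e`. -/
noncomputable def opticalMatrix (g : LorentzianMetric d M)
    (e : OpenPartialHomeomorph M (EuclideanSpace ℝ (Fin d)))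
    (ℓ : ∀ p : M, TangentSpace (𝓡 d) p) (p : M)
    (m : Fin (d - 2) → TangentSpace (𝓡 d) p) : Matrix (Fin (d - 2)) (Fin (d - 2)) ℝ :=
  Matrix.of fun i j => g.coord e (e p) (comps e p (m i)) (g.covDeriv e ℓ p (m j))

end LorentzianMetric

/-- The `k × k` matrix with upper left block `½ (r, a; -a, r)` and zeros elsewhere. -/
noncomputable def typeNOpticalBlock (k : ℕ) (r a : ℝ) : Matrix (Fin k) (Fin k) ℝ :=
  Matrix.of fun i j =>
    if (i : ℕ) = j ∧ (i : ℕ) < 2 then r / 2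
    else if (i : ℕ) = 0 ∧ (j : ℕ) = 1 then a / 2
    else if (i : ℕ) = 1 ∧ (j : ℕ) = 0 then -a / 2
    else 0

/-! Work in one chart and let L be the endomorphism u ↦ ∇_u ℓ. For an Einstein metric the Weyl
tensor is W(u,v) = R(u,v) − K u∧v with K = Λ/(d−1). The subtracted part is parallel, so W itself
satisfies the second Bianchi identity. Type N means, without reference to a frame, that W contracted
with ℓ vanishes and that ℓ♭ ∧ W = 0 (`isTypeN_of_frame`). W is then determined by the symmetric
trace-free matrix Ψ_ij = W(n,m_i,n,m_j). Differentiating the two identities and summing cyclically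
by Bianchi gives algebraic relations between Ψ and L (`weylOp_covDeriv_cyclic`,
`weylOp_optical_cyclic`).

Where W ≠ 0, these relations force κ = 0, make Ψρ symmetric and tie ρ to Ψ by a wedge relation. In
an eigenbasis of Ψ there are two cases: three or more non-zero eigenvalues make ρ vanish, and
otherwise the eigenvalues are p, −p, 0, …, 0 and ρ is the asserted block (`optical_normal_form`). At
a point of the support where W = 0 the relations say nothing, but the block form survives limits
because the rotations range over a compact set (`exists_normal_form_of_tendsto`).

If the expansion vanishes near a point with W ≠ 0, a Raychaudhuri identity (`trace_sq_covDerivOp`)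
with Ric(ℓ,ℓ) = 0 gives tr ρ² = 0. A block of zero trace is antisymmetric, so tr ρ² = −|ρ|² and ρ =
0. Continuity extends κ = 0 and ρ = 0 to the support. -/

section

open Filter Topology

set_option maxSynthPendingDepth 3

/-! ## Connections on a vector space -/

section Connection

variable {E : Type*} [NormedAddCommGroup E] [NormedSpace ℝ E]

/-- The curvature operator `R(u, v)` of the connection with connection form `Γ`. -/
noncomputable def curvOp (Γ : E → E →L[ℝ] E →L[ℝ] E) (x u v : E) : E →L[ℝ] E :=
  fderiv ℝ Γ x u v - fderiv ℝ Γ x v u + (Γ x u).comp (Γ x v) - (Γ x v).comp (Γ x u)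

/-- The curvature operator with the part of constant sectional curvature `K` removed. -/
noncomputable def weylOp (G : E → E →L[ℝ] E →L[ℝ] ℝ) (Γ : E → E →L[ℝ] E →L[ℝ] E) (K : ℝ)
    (x u v : E) : E →L[ℝ] E :=
  curvOp Γ x u v - K • ((G x v).smulRight u - (G x u).smulRight v)

/-- The endomorphism `u ↦ ∇_u X`. -/
noncomputable def covDerivOp (Γ : E → E →L[ℝ] E →L[ℝ] E) (X : E → E) (x : E) : E →L[ℝ] E :=
  fderiv ℝ X x + (Γ x).flip (X x)

variable {G : E → E →L[ℝ] E →L[ℝ] ℝ} {Γ : E → E →L[ℝ] E →L[ℝ] E} {X : E → E} {K : ℝ} {x : E}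

lemma ContDiffAt.hasFDerivAt_fderiv {F : Type*} [NormedAddCommGroup F] [NormedSpace ℝ F]
    {f : E → F} (hf : ContDiffAt ℝ ∞ f x) :
    HasFDerivAt (fderiv ℝ f) (fderiv ℝ (fderiv ℝ f) x) x :=
  ((hf.fderiv_right (m := 1) (WithTop.coe_le_coe.2 le_top)).differentiableAt one_ne_zero).hasFDerivAt

lemma ContDiffAt.hasFDerivAt_of_infty {F : Type*} [NormedAddCommGroup F] [NormedSpace ℝ F]
    {f : E → F} (hf : ContDiffAt ℝ ∞ f x) : HasFDerivAt f (fderiv ℝ f x) x :=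
  (hf.differentiableAt (by simp)).hasFDerivAt

lemma ContDiffAt.fderiv_fderiv_comm {F : Type*} [NormedAddCommGroup F] [NormedSpace ℝ F]
    {f : E → F} (hf : ContDiffAt ℝ ∞ f x) (u v : E) :
    fderiv ℝ (fderiv ℝ f) x u v = fderiv ℝ (fderiv ℝ f) x v u :=
  (hf.isSymmSndFDerivAt (by simpa using (WithTop.coe_le_coe.2 le_top : ((2 : ℕ∞) : WithTop ℕ∞) ≤ ∞))) u v

lemma hasFDerivAt_curvOp (hΓ : ContDiffAt ℝ ∞ Γ x) (v w : E) :
    ∃ R' : E →L[ℝ] E →L[ℝ] E, HasFDerivAt (fun y => curvOp Γ y v w) R' x ∧ ∀ u b,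
      R' u b = fderiv ℝ (fderiv ℝ Γ) x u v w b - fderiv ℝ (fderiv ℝ Γ) x u w v b
        + fderiv ℝ Γ x u v (Γ x w b) + Γ x v (fderiv ℝ Γ x u w b)
        - fderiv ℝ Γ x u w (Γ x v b) - Γ x w (fderiv ℝ Γ x u v b) := by
  have h2 := hΓ.hasFDerivAt_fderiv
  have h1 := hΓ.hasFDerivAt_of_infty
  have e1 := fun a : E => h1.clm_apply (hasFDerivAt_const a x)
  have e2 := fun a b : E =>
    (h2.clm_apply (hasFDerivAt_const a x)).clm_apply (hasFDerivAt_const b x)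
  refine ⟨_, (((e2 v w).sub (e2 w v)).add ((e1 v).clm_comp (e1 w))).sub
    ((e1 w).clm_comp (e1 v)), fun u b => ?_⟩
  simp
  abel

lemma curvOp_swap (u v : E) : curvOp Γ x u v = -curvOp Γ x v u := by
  simp only [curvOp]; abel

lemma weylOp_swap (u v : E) : weylOp G Γ K x u v = -weylOp G Γ K x v u := by
  simp only [weylOp, curvOp_swap u v]
  module

/-- This is d_∇ R = 0: second derivatives of Γ cancel by symmetry, the rest algebraically. Each
bracket differentiates only the endomorphism part. The terms R(∇_u v, w) are left out, so torsion
freeness is not needed. -/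
lemma curvOp_bianchi (hΓ : ContDiffAt ℝ ∞ Γ x) (u v w b : E) :
    (fderiv ℝ (fun y => curvOp Γ y v w) x u b + Γ x u (curvOp Γ x v w b)
        - curvOp Γ x v w (Γ x u b))
      + (fderiv ℝ (fun y => curvOp Γ y w u) x v b + Γ x v (curvOp Γ x w u b)
        - curvOp Γ x w u (Γ x v b))
      + (fderiv ℝ (fun y => curvOp Γ y u v) x w b + Γ x w (curvOp Γ x u v b)
        - curvOp Γ x u v (Γ x w b)) = 0 := by
  obtain ⟨R1, h1, h1'⟩ := hasFDerivAt_curvOp hΓ v w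
  obtain ⟨R2, h2, h2'⟩ := hasFDerivAt_curvOp hΓ w u
  obtain ⟨R3, h3, h3'⟩ := hasFDerivAt_curvOp hΓ u v
  rw [h1.fderiv, h2.fderiv, h3.fderiv, h1', h2', h3', hΓ.fderiv_fderiv_comm v u,
    hΓ.fderiv_fderiv_comm w u, hΓ.fderiv_fderiv_comm w v]
  simp [curvOp]
  abel

/-- `∇G = 0` near `x`. -/
def IsMetricAt (G : E → E →L[ℝ] E →L[ℝ] ℝ) (Γ : E → E →L[ℝ] E →L[ℝ] E) (x : E) : Prop :=
  ∀ᶠ y in 𝓝 x, ∀ u a b, fderiv ℝ G y u a b = G y (Γ y u a) b + G y a (Γ y u b)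

/-- Torsion freeness near `x`. -/
def IsTorsionFreeAt (Γ : E → E →L[ℝ] E →L[ℝ] E) (x : E) : Prop :=
  ∀ᶠ y in 𝓝 x, ∀ u v, Γ y u v = Γ y v u

lemma curvOp_cyclic (hΓ : ContDiffAt ℝ ∞ Γ x) (hs : IsTorsionFreeAt Γ x) (u v w : E) :
    curvOp Γ x u v w + curvOp Γ x v w u + curvOp Γ x w u v = 0 := by
  have hd : ∀ c a b, fderiv ℝ Γ x c a b = fderiv ℝ Γ x c b a := by
    intro c a b
    have h1 := hΓ.hasFDerivAt_of_infty
    have e2 := fun a b : E =>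
      (h1.clm_apply (hasFDerivAt_const a x)).clm_apply (hasFDerivAt_const b x)
    have e := (e2 a b).congr_of_eventuallyEq (f₁ := fun y => Γ y b a)
      (hs.mono fun y hy => hy b a)
    have := congrArg (fun T => T c) (e.unique (e2 b a))
    simpa using this
  have h0 := hs.self_of_nhds
  simp only [curvOp, sub_apply, add_apply,
    ContinuousLinearMap.comp_apply]
  rw [hd u v w, hd v w u, hd w u v, h0 v w, h0 w u, h0 u v]
  abel

/-- Second derivatives of G(a, b) commute. Expanding them by ∇G = 0 and antisymmetrising in u, v
leaves the action of the curvature on G. -/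
lemma curvOp_skew (hG : ContDiffAt ℝ ∞ G x) (hΓ : ContDiffAt ℝ ∞ Γ x) (hm : IsMetricAt G Γ x)
    (u v a b : E) : G x (curvOp Γ x u v a) b + G x a (curvOp Γ x u v b) = 0 := by
  have g1 := hG.hasFDerivAt_of_infty
  have g2 := hG.hasFDerivAt_fderiv
  have h1 := hΓ.hasFDerivAt_of_infty
  have c := fun a : E => hasFDerivAt_const (𝕜 := ℝ) a x
  have key : ∀ u v, fderiv ℝ (fderiv ℝ G) x u v a b =
      fderiv ℝ G x u (Γ x v a) b + G x (fderiv ℝ Γ x u v a) b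
      + fderiv ℝ G x u a (Γ x v b) + G x a (fderiv ℝ Γ x u v b) := by
    intro u v
    have l := ((g2.clm_apply (c v)).clm_apply (c a)).clm_apply (c b)
    have r1 := (g1.clm_apply ((h1.clm_apply (c v)).clm_apply (c a))).clm_apply (c b)
    have r2 := (g1.clm_apply (c a)).clm_apply ((h1.clm_apply (c v)).clm_apply (c b))
    have e := l.congr_of_eventuallyEq
      (f₁ := fun y => G y (Γ y v a) b + G y a (Γ y v b)) (hm.mono fun y hy => (hy v a b).symm)
    have := congrArg (fun T => T u) (e.unique (r1.add r2))
    simp at this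
    rw [this]; abel
  have e := key u v
  rw [hG.fderiv_fderiv_comm, key v u] at e
  have h0 := hm.self_of_nhds
  simp only [h0] at e
  simp only [curvOp, sub_apply, add_apply,
    ContinuousLinearMap.comp_apply, map_sub, map_add]
  linarith

lemma hasFDerivAt_weylOp (hG : ContDiffAt ℝ ∞ G x) (hΓ : ContDiffAt ℝ ∞ Γ x) (v w : E) :
    HasFDerivAt (fun y => weylOp G Γ K y v w) (fderiv ℝ (fun y => weylOp G Γ K y v w) x) x ∧
    ∀ u b, fderiv ℝ (fun y => weylOp G Γ K y v w) x u b =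
      fderiv ℝ (fun y => curvOp Γ y v w) x u b
        - K • (fderiv ℝ G x u w b • v - fderiv ℝ G x u v b • w) := by
  obtain ⟨R', hR, -⟩ := hasFDerivAt_curvOp hΓ v w
  have g1 := hG.hasFDerivAt_of_infty
  have e1 := fun a b : E =>
    ((ContinuousLinearMap.smulRightL ℝ E E).flip b).hasFDerivAt.comp x
      (g1.clm_apply (hasFDerivAt_const a x))
  have h := hR.sub (((e1 w v).sub (e1 v w)).const_smul K)
  have h' : HasFDerivAt (fun y => weylOp G Γ K y v w) _ x := h
  refine ⟨h'.differentiableAt.hasFDerivAt, fun u b => ?_⟩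
  rw [h'.fderiv, hR.fderiv]
  simp

/-- The subtracted part is built from G alone, so its covariant exterior derivative vanishes by ∇G =
0 and torsion freeness. -/
lemma weylOp_bianchi (hG : ContDiffAt ℝ ∞ G x) (hΓ : ContDiffAt ℝ ∞ Γ x)
    (hm : IsMetricAt G Γ x) (hs : IsTorsionFreeAt Γ x) (u v w b : E) :
    (fderiv ℝ (fun y => weylOp G Γ K y v w) x u b + Γ x u (weylOp G Γ K x v w b)
        - weylOp G Γ K x v w (Γ x u b))
      + (fderiv ℝ (fun y => weylOp G Γ K y w u) x v b + Γ x v (weylOp G Γ K x w u b)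
        - weylOp G Γ K x w u (Γ x v b))
      + (fderiv ℝ (fun y => weylOp G Γ K y u v) x w b + Γ x w (weylOp G Γ K x u v b)
        - weylOp G Γ K x u v (Γ x w b)) = 0 := by
  rw [(hasFDerivAt_weylOp hG hΓ v w).2, (hasFDerivAt_weylOp hG hΓ w u).2,
    (hasFDerivAt_weylOp hG hΓ u v).2]
  have h0 := hm.self_of_nhds
  have s0 := hs.self_of_nhds
  have := curvOp_bianchi hΓ u v w b
  simp only [h0, weylOp, sub_apply, smul_apply,
    ContinuousLinearMap.smulRight_apply, map_sub, map_smul] at this ⊢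
  rw [s0 v u, s0 w u, s0 w v]
  refine Eq.trans ?_ this
  module

lemma weylOp_cyclic (hΓ : ContDiffAt ℝ ∞ Γ x) (hs : IsTorsionFreeAt Γ x)
    (hsym : ∀ a b, G x a b = G x b a) (u v w : E) :
    weylOp G Γ K x u v w + weylOp G Γ K x v w u + weylOp G Γ K x w u v = 0 := by
  have := curvOp_cyclic hΓ hs u v w
  simp only [weylOp, sub_apply, smul_apply,
    ContinuousLinearMap.smulRight_apply]
  rw [hsym v w, hsym u w, hsym u v, ← this]
  module

lemma weylOp_skew (hG : ContDiffAt ℝ ∞ G x) (hΓ : ContDiffAt ℝ ∞ Γ x) (hm : IsMetricAt G Γ x)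
    (hsym : ∀ a b, G x a b = G x b a) (u v a b : E) :
    G x (weylOp G Γ K x u v a) b + G x a (weylOp G Γ K x u v b) = 0 := by
  have := curvOp_skew hG hΓ hm u v a b
  simp only [weylOp, sub_apply, smul_apply,
    ContinuousLinearMap.smulRight_apply, map_sub, map_smul, smul_eq_mul]
  rw [hsym a u, hsym a v]
  linarith

/-- The derivative of `G(X, b)`. -/
lemma hasFDerivAt_metric_apply (hG : ContDiffAt ℝ ∞ G x) (hm : IsMetricAt G Γ x)
    (hX : ContDiffAt ℝ ∞ X x) (b : E) :
    ∃ l : E →L[ℝ] ℝ, HasFDerivAt (fun y => G y (X y) b) l x ∧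
      ∀ u, l u = G x (covDerivOp Γ X x u) b + G x (X x) (Γ x u b) := by
  refine ⟨_, (hG.hasFDerivAt_of_infty.clm_apply hX.hasFDerivAt_of_infty).clm_apply
    (hasFDerivAt_const b x), fun u => ?_⟩
  simp [covDerivOp, hm.self_of_nhds]
  ring

lemma metric_covDerivOp_self (hG : ContDiffAt ℝ ∞ G x) (hm : IsMetricAt G Γ x)
    (hX : ContDiffAt ℝ ∞ X x) (hsym : ∀ a b, G x a b = G x b a)
    (hnull : ∀ᶠ y in 𝓝 x, G y (X y) (X y) = 0) (u : E) :
    G x (covDerivOp Γ X x u) (X x) = 0 := by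
  have h := (hG.hasFDerivAt_of_infty.clm_apply hX.hasFDerivAt_of_infty).clm_apply
    hX.hasFDerivAt_of_infty
  have h0 := (hasFDerivAt_const (𝕜 := ℝ) (0 : ℝ) x).congr_of_eventuallyEq hnull
  have := congrArg (fun T => T u) (h.unique h0)
  simp [hm.self_of_nhds] at this
  simp only [covDerivOp, add_apply, ContinuousLinearMap.flip_apply, map_add]
  rw [hsym (X x) (Γ x u (X x)), hsym (X x)] at this
  linarith

/-- Differentiating W(v,w)X = 0 gives (∇_u W)(v,w)X = −W(v,w)∇_u X, and the cyclic sum of the left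
side vanishes by Bianchi. -/
lemma weylOp_covDeriv_cyclic (hG : ContDiffAt ℝ ∞ G x) (hΓ : ContDiffAt ℝ ∞ Γ x)
    (hm : IsMetricAt G Γ x) (hs : IsTorsionFreeAt Γ x) (hX : ContDiffAt ℝ ∞ X x)
    (h1 : ∀ᶠ y in 𝓝 x, ∀ v w, weylOp G Γ K y v w (X y) = 0) (u v w : E) :
    weylOp G Γ K x v w (covDerivOp Γ X x u) + weylOp G Γ K x w u (covDerivOp Γ X x v)
      + weylOp G Γ K x u v (covDerivOp Γ X x w) = 0 := by
  have key : ∀ u v w, weylOp G Γ K x v w (fderiv ℝ X x u) =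
      -fderiv ℝ (fun y => weylOp G Γ K y v w) x u (X x) := by
    intro u v w
    have h := (hasFDerivAt_weylOp (K := K) hG hΓ v w).1.clm_apply hX.hasFDerivAt_of_infty
    have h0 := (hasFDerivAt_const (𝕜 := ℝ) (0 : E) x).congr_of_eventuallyEq
      (h1.mono fun y hy => hy v w)
    have := congrArg (fun T => T u) (h.unique h0)
    simp at this
    exact eq_neg_of_add_eq_zero_left this
  have hb := weylOp_bianchi (K := K) hG hΓ hm hs u v w (X x)
  simp only [h1.self_of_nhds, map_zero, add_zero] at hb
  simp only [covDerivOp, add_apply, ContinuousLinearMap.flip_apply, map_add,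
    key]
  rw [← neg_eq_zero, ← hb]
  abel

/-- The hypothesis `h2` is X♭ ∧ W(v,w) = 0. Its derivative, evaluated on n and on a, b orthogonal to
X, expresses the a, b component of ∇_u W through ∇_u X. Bianchi then removes ∇W. -/
lemma weylOp_optical_cyclic (hG : ContDiffAt ℝ ∞ G x) (hΓ : ContDiffAt ℝ ∞ Γ x)
    (hm : IsMetricAt G Γ x) (hs : IsTorsionFreeAt Γ x) (hX : ContDiffAt ℝ ∞ X x)
    (h2 : ∀ᶠ y in 𝓝 x, ∀ a b c v w, G y (X y) a * G y (weylOp G Γ K y v w b) c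
      + G y (X y) b * G y (weylOp G Γ K y v w c) a
      + G y (X y) c * G y (weylOp G Γ K y v w a) b = 0)
    (hsym : ∀ a b, G x a b = G x b a)
    {n a b : E} (hn : G x (X x) n = 1) (ha : G x (X x) a = 0) (hb : G x (X x) b = 0)
    (u v w : E) :
    (G x (covDerivOp Γ X x u) a * G x (weylOp G Γ K x v w b) n
        + G x (covDerivOp Γ X x u) b * G x (weylOp G Γ K x v w n) a)
      + (G x (covDerivOp Γ X x v) a * G x (weylOp G Γ K x w u b) n
        + G x (covDerivOp Γ X x v) b * G x (weylOp G Γ K x w u n) a)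
      + (G x (covDerivOp Γ X x w) a * G x (weylOp G Γ K x u v b) n
        + G x (covDerivOp Γ X x w) b * G x (weylOp G Γ K x u v n) a) = 0 := by
  have hab : ∀ v w, G x (weylOp G Γ K x v w a) b = 0 := by
    intro v w
    have := h2.self_of_nhds a b n v w
    simpa [ha, hb, hn] using this
  have key : ∀ u v w, G x (fderiv ℝ (fun y => weylOp G Γ K y v w) x u a) b
      + G x (Γ x u (weylOp G Γ K x v w a)) b - G x (weylOp G Γ K x v w (Γ x u a)) b
      = - (G x (covDerivOp Γ X x u) a * G x (weylOp G Γ K x v w b) n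
        + G x (covDerivOp Γ X x u) b * G x (weylOp G Γ K x v w n) a) := by
    intro u v w
    obtain ⟨la, Ha, Ha'⟩ := hasFDerivAt_metric_apply hG hm hX a
    obtain ⟨lb, Hb, Hb'⟩ := hasFDerivAt_metric_apply hG hm hX b
    obtain ⟨ln, Hn, -⟩ := hasFDerivAt_metric_apply hG hm hX n
    have c := fun a : E => hasFDerivAt_const (𝕜 := ℝ) a x
    have W := fun b c' => (hG.hasFDerivAt_of_infty.clm_apply
      ((hasFDerivAt_weylOp (K := K) hG hΓ v w).1.clm_apply (c b))).clm_apply (c c')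
    have h := ((Ha.mul (W b n)).add (Hb.mul (W n a))).add (Hn.mul (W a b))
    have h0 := (hasFDerivAt_const (𝕜 := ℝ) (0 : ℝ) x).congr_of_eventuallyEq
      (h2.mono fun y hy => hy a b n v w)
    have e := congrArg (fun T => T u) (h.unique h0)
    simp [hm.self_of_nhds, ha, hb, hn, hab, Ha', Hb'] at e
    -- Differentiating G(X, a) and G(X, b) leaves terms in G(X, Γ_u a) and G(X, Γ_u b). The wedge
    -- identity at x turns them into the Γ-terms of the covariant derivative of W.
    have e1 := h2.self_of_nhds (Γ x u b) n a v w
    have e2 := h2.self_of_nhds (Γ x u a) b n v w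
    simp only [ha, hb, hn] at e1 e2
    have e3 := hsym (weylOp G Γ K x v w a) (Γ x u b)
    linarith
  have hB := congrArg (fun z => G x z b) (weylOp_bianchi (K := K) hG hΓ hm hs u v w a)
  simp only [map_add, map_sub, map_zero, add_apply,
    sub_apply, zero_apply] at hB
  linarith [key u v w, key v w u, key w u v]

end Connection

/-! ### Ricci identity and Raychaudhuri equation -/

section Raychaudhuri

variable {E : Type*} [NormedAddCommGroup E] [NormedSpace ℝ E]

/-- The trace of an endomorphism of a finite-dimensional space, as a continuous linear map. -/
noncomputable def traceCLM (E : Type*) [NormedAddCommGroup E] [NormedSpace ℝ E]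
    [FiniteDimensional ℝ E] : (E →L[ℝ] E) →L[ℝ] ℝ :=
  LinearMap.toContinuousLinearMap
    ((LinearMap.trace ℝ E).comp (ContinuousLinearMap.coeLM ℝ))

lemma traceCLM_apply [FiniteDimensional ℝ E] (T : E →L[ℝ] E) : traceCLM E T = LinearMap.trace ℝ E T.toLinearMap := rfl

lemma traceCLM_comp_comm [FiniteDimensional ℝ E] (S T : E →L[ℝ] E) : traceCLM E (S.comp T) = traceCLM E (T.comp S) := by
  simp only [traceCLM_apply, ContinuousLinearMap.toLinearMap_comp]
  exact LinearMap.trace_mul_comm ℝ S.toLinearMap T.toLinearMap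

lemma traceCLM_smulRight [FiniteDimensional ℝ E] (f : E →L[ℝ] ℝ) (v : E) : traceCLM E (f.smulRight v) = f v := by
  rw [traceCLM_apply]
  exact LinearMap.trace_smulRight f.toLinearMap v

variable {Γ : E → E →L[ℝ] E →L[ℝ] E} {X : E → E} {x : E}

lemma hasFDerivAt_covDerivOp (hΓ : ContDiffAt ℝ ∞ Γ x) (hX : ContDiffAt ℝ ∞ X x) :
    ∃ L' : E →L[ℝ] E →L[ℝ] E, HasFDerivAt (covDerivOp Γ X) L' x ∧ ∀ u v,
      L' u v = fderiv ℝ (fderiv ℝ X) x u v + fderiv ℝ Γ x u v (X x) + Γ x v (fderiv ℝ X x u) := by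
  have h := hX.hasFDerivAt_fderiv.add
    (((ContinuousLinearMap.flipₗᵢ ℝ E E E).toContinuousLinearEquiv.hasFDerivAt.comp x
      hΓ.hasFDerivAt_of_infty).clm_apply hX.hasFDerivAt_of_infty)
  refine ⟨_, h, fun u v => ?_⟩
  simp
  abel

lemma covDerivOp_ricci_identity (hX : ContDiffAt ℝ ∞ X x) {L' : E →L[ℝ] E →L[ℝ] E}
    (hL' : ∀ u v, L' u v = fderiv ℝ (fderiv ℝ X) x u v + fderiv ℝ Γ x u v (X x)
      + Γ x v (fderiv ℝ X x u)) (u v : E) :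
    L' u v - L' v u + Γ x u (covDerivOp Γ X x v) - Γ x v (covDerivOp Γ X x u)
      = curvOp Γ x u v (X x) := by
  rw [hL', hL', hX.fderiv_fderiv_comm v u]
  simp [covDerivOp, curvOp]
  abel

/-- Raychaudhuri's equation with the divergence θ = tr L as the factor in ∇_X X = θX, so no affine
reparametrisation is needed. Tracing the Ricci identity (∇_u L)X − (∇_X L)u = R(u,X)X gives X(θ) +
θ² − tr L² − X(θ), and the right side is traceless by `hric`. -/
lemma trace_sq_covDerivOp [FiniteDimensional ℝ E] (hΓ : ContDiffAt ℝ ∞ Γ x) (hs : IsTorsionFreeAt Γ x)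
    (hX : ContDiffAt ℝ ∞ X x)
    (hdiv : ∀ᶠ y in 𝓝 x,
      covDerivOp Γ X y (X y) = traceCLM E (covDerivOp Γ X y) • X y)
    (hric : ∀ T : E →L[ℝ] E, (∀ u, T u = curvOp Γ x u (X x) (X x)) → traceCLM E T = 0) :
    traceCLM E ((covDerivOp Γ X x).comp (covDerivOp Γ X x))
      = traceCLM E (covDerivOp Γ X x) ^ 2 := by
  obtain ⟨L', h, hL'⟩ := hasFDerivAt_covDerivOp hΓ hX
  set L := covDerivOp Γ X x with hL
  have hX1 := hX.hasFDerivAt_of_infty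
  have hd := ((h.clm_apply hX1).congr_of_eventuallyEq (hdiv.mono fun y hy => hy.symm)).unique
    (((traceCLM E).hasFDerivAt.comp x h).smul hX1)
  have e1 : ∀ u, L' u (X x) =
      traceCLM E L • fderiv ℝ X x u + traceCLM E (L' u) • X x - L (fderiv ℝ X x u) := by
    intro u
    have := congrArg (fun T => T u) hd
    simp at this
    rw [eq_sub_iff_add_eq, ← this, hL]
    abel
  -- This endomorphism is u ↦ R(u,X)X written by the Ricci identity. The `smulRight` summand and `L'
  -- (X x)` have equal traces, so the derivative of the divergence drops out.
  have e2 := hric (traceCLM E L • fderiv ℝ X x + ((traceCLM E).comp L').smulRight (X x)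
    - L.comp (fderiv ℝ X x) - L' (X x) + traceCLM E L • (Γ x).flip (X x)
    - (Γ x (X x)).comp L) (by
      intro u
      rw [← covDerivOp_ricci_identity hX hL', e1, hdiv.self_of_nhds, ← hL]
      simp)
  simp only [map_add, map_sub, map_smul, traceCLM_smulRight, smul_eq_mul,
    ContinuousLinearMap.comp_apply] at e2
  rw [traceCLM_comp_comm (Γ x (X x))] at e2
  have e3 : Γ x (X x) = (Γ x).flip (X x) := by
    ext u; simpa using hs.self_of_nhds (X x) u
  have e4 : L.comp L = L.comp (fderiv ℝ X x) + L.comp ((Γ x).flip (X x)) := by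
    rw [← ContinuousLinearMap.comp_add]; rfl
  have e5 : traceCLM E L = traceCLM E (fderiv ℝ X x) + traceCLM E ((Γ x).flip (X x)) := by
    rw [← map_add]; rfl
  rw [e3] at e2
  rw [e4, map_add, sq]
  nth_rw 2 [e5]
  linarith

end Raychaudhuri

/-! ### The Levi-Civita connection and the Weyl tensor of an Einstein metric in coordinates -/

namespace CoordMetric

variable {d : ℕ} {G : EuclideanSpace ℝ (Fin d) →
      EuclideanSpace ℝ (Fin d) →L[ℝ] EuclideanSpace ℝ (Fin d) →L[ℝ] ℝ}
  {x : EuclideanSpace ℝ (Fin d)}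

/-- The Christoffel symbols as a bilinear map. -/
noncomputable def christoffelCLM
    (G : EuclideanSpace ℝ (Fin d) →
      EuclideanSpace ℝ (Fin d) →L[ℝ] EuclideanSpace ℝ (Fin d) →L[ℝ] ℝ)
    (x : EuclideanSpace ℝ (Fin d)) :
    EuclideanSpace ℝ (Fin d) →L[ℝ] EuclideanSpace ℝ (Fin d) →L[ℝ] EuclideanSpace ℝ (Fin d) :=
  (ContinuousLinearMap.compL ℝ (EuclideanSpace ℝ (Fin d)) (EuclideanSpace ℝ (Fin d) →L[ℝ] ℝ)
    (EuclideanSpace ℝ (Fin d)) (G x).inverse).comp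
    ((1 / 2 : ℝ) • (fderiv ℝ G x + (fderiv ℝ G x).flip
      - (ContinuousLinearMap.flipₗᵢ ℝ (EuclideanSpace ℝ (Fin d)) (EuclideanSpace ℝ (Fin d))
          ℝ).toContinuousLinearEquiv.toContinuousLinearMap.comp (fderiv ℝ G x).flip))

lemma christoffelCLM_apply (u v : EuclideanSpace ℝ (Fin d)) :
    christoffelCLM G x u v = christoffel G x u v := by
  simp [christoffelCLM, christoffel]

/-- `G` is a smooth field of nondegenerate symmetric bilinear forms near `x`. -/
structure IsPseudoMetricAt (G : EuclideanSpace ℝ (Fin d) →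
      EuclideanSpace ℝ (Fin d) →L[ℝ] EuclideanSpace ℝ (Fin d) →L[ℝ] ℝ)
    (x : EuclideanSpace ℝ (Fin d)) : Prop where
  smooth : ∀ᶠ y in 𝓝 x, ContDiffAt ℝ ∞ G y
  symm : ∀ᶠ y in 𝓝 x, ∀ a b, G y a b = G y b a
  invertible : ∀ᶠ y in 𝓝 x, (G y).IsInvertible

lemma IsPseudoMetricAt.eventually (h : IsPseudoMetricAt G x) :
    ∀ᶠ y in 𝓝 x, IsPseudoMetricAt G y := by
  filter_upwards [h.smooth.eventually_nhds, h.symm.eventually_nhds, h.invertible.eventually_nhds]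
    with y h1 h2 h3 using ⟨h1, h2, h3⟩

lemma fderiv_symm (h : IsPseudoMetricAt G x) (u a b : EuclideanSpace ℝ (Fin d)) :
    fderiv ℝ G x u a b = fderiv ℝ G x u b a := by
  have g := h.smooth.self_of_nhds.hasFDerivAt_of_infty
  have e := fun a b : EuclideanSpace ℝ (Fin d) =>
    (g.clm_apply (hasFDerivAt_const a x)).clm_apply (hasFDerivAt_const b x)
  have := congrArg (fun T => T u) (((e a b).congr_of_eventuallyEq
    (f₁ := fun y => G y b a) (h.symm.mono fun y hy => hy b a)).unique (e b a))
  simpa using this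

lemma metric_christoffel (h : IsPseudoMetricAt G x) (u v w : EuclideanSpace ℝ (Fin d)) :
    G x (christoffelCLM G x u v) w =
      1 / 2 * (fderiv ℝ G x u v w + fderiv ℝ G x v u w - fderiv ℝ G x w u v) := by
  obtain ⟨e, he⟩ := h.invertible.self_of_nhds
  rw [christoffelCLM_apply, christoffel, ← he, ContinuousLinearMap.inverse_equiv]
  simp

lemma IsPseudoMetricAt.isMetricAt (h : IsPseudoMetricAt G x) :
    IsMetricAt G (christoffelCLM G) x := by
  filter_upwards [h.eventually, h.symm] with y hy hs u a b
  rw [hs a, metric_christoffel hy, metric_christoffel hy, fderiv_symm hy b u a,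
    fderiv_symm hy a u b, fderiv_symm hy u b a]
  ring

lemma IsPseudoMetricAt.isTorsionFreeAt (h : IsPseudoMetricAt G x) :
    IsTorsionFreeAt (christoffelCLM G) x := by
  filter_upwards [h.eventually] with y hy u v
  obtain ⟨e, he⟩ := hy.invertible.self_of_nhds
  apply e.injective
  ext w
  have := metric_christoffel hy u v w
  have h2 := metric_christoffel hy v u w
  rw [fderiv_symm hy w v u] at h2
  rw [← he] at this h2
  simp only [ContinuousLinearEquiv.coe_coe] at this h2
  rw [this, h2]
  ring

lemma IsPseudoMetricAt.contDiffAt_christoffelCLM (h : IsPseudoMetricAt G x) :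
    ContDiffAt ℝ ∞ (christoffelCLM G) x := by
  have hG := h.smooth.self_of_nhds
  have hD : ContDiffAt ℝ ∞ (fderiv ℝ G) x := hG.fderiv_right (by simp)
  obtain ⟨e, he⟩ := h.invertible.self_of_nhds
  have hI : ContDiffAt ℝ ∞ (fun y => (G y).inverse) x := by
    have := contDiffAt_map_inverse (n := ∞) e
    rw [he] at this
    exact this.comp x hG
  have hF : ContDiffAt ℝ ∞ (fun y => (fderiv ℝ G y).flip) x :=
    (ContinuousLinearMap.flipₗᵢ ℝ (EuclideanSpace ℝ (Fin d)) (EuclideanSpace ℝ (Fin d))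
      (EuclideanSpace ℝ (Fin d) →L[ℝ] ℝ)).toContinuousLinearEquiv.contDiff.contDiffAt.comp x hD
  exact ((ContinuousLinearMap.contDiff _).contDiffAt.comp x hI).clm_comp
    (((hD.add hF).sub (contDiffAt_const.clm_comp hF)).const_smul _)

lemma curvature_eq_curvOp (h : IsPseudoMetricAt G x) (u v w : EuclideanSpace ℝ (Fin d)) :
    curvature G x u v w = curvOp (christoffelCLM G) x u v w := by
  have h1 := h.contDiffAt_christoffelCLM.hasFDerivAt_of_infty
  have e : ∀ v w u, fderiv ℝ (fun y => christoffel G y v w) x u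
      = fderiv ℝ (christoffelCLM G) x u v w := by
    intro v w u
    simp only [← christoffelCLM_apply]
    rw [((h1.clm_apply (hasFDerivAt_const v x)).clm_apply (hasFDerivAt_const w x)).fderiv]
    simp
  simp only [curvature, e, curvOp]
  simp only [← christoffelCLM_apply]
  simp

lemma covDeriv_eq_covDerivOp (X : EuclideanSpace ℝ (Fin d) → EuclideanSpace ℝ (Fin d))
    (u : EuclideanSpace ℝ (Fin d)) :
    covDeriv G X x u = covDerivOp (christoffelCLM G) X x u := by
  simp [covDeriv, covDerivOp, christoffelCLM_apply]

lemma traceCLM_eq_sum (T : EuclideanSpace ℝ (Fin d) →L[ℝ] EuclideanSpace ℝ (Fin d)) :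
    traceCLM _ T = ∑ i : Fin d, (T (EuclideanSpace.single i 1)) i := by
  rw [traceCLM_apply, LinearMap.trace_eq_sum_inner _ (EuclideanSpace.basisFun (Fin d) ℝ)]
  simp [EuclideanSpace.inner_single_left]

lemma ricci_eq_trace (h : IsPseudoMetricAt G x) {v w : EuclideanSpace ℝ (Fin d)}
    {T : EuclideanSpace ℝ (Fin d) →L[ℝ] EuclideanSpace ℝ (Fin d)}
    (hT : ∀ u, T u = curvOp (christoffelCLM G) x u v w) : ricci G x v w = traceCLM _ T := by
  rw [traceCLM_eq_sum, ricci]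
  simp [hT, curvature_eq_curvOp h]

lemma scalar_of_einstein (h : IsPseudoMetricAt G x) {Λ : ℝ}
    (hE : ∀ v w, ricci G x v w = Λ * G x v w) : scalar G x = Λ * d := by
  obtain ⟨e, he⟩ := h.invertible.self_of_nhds
  have : ∀ i : Fin d, ricci G x (EuclideanSpace.single i 1)
    ((G x).inverse (EuclideanSpace.proj i : EuclideanSpace ℝ (Fin d) →L[ℝ] ℝ)) = Λ := by
    intro i
    rw [hE, h.symm.self_of_nhds, ← he, ContinuousLinearMap.inverse_equiv]
    simp
  simp [scalar, this, mul_comm]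

/-- With Ric = Λg and scalar curvature Λd, the Ricci and scalar corrections are multiples of the
same tensor, and −2Λ/(d−2) + Λd/((d−1)(d−2)) = −Λ/(d−1). -/
lemma weyl_of_einstein (hd : 4 ≤ d) (h : IsPseudoMetricAt G x) {Λ : ℝ}
    (hE : ∀ v w, ricci G x v w = Λ * G x v w) (a b c e : EuclideanSpace ℝ (Fin d)) :
    weyl G x a b c e = G x (weylOp G (christoffelCLM G) (Λ / (d - 1)) x c e b) a := by
  have hd' : (4 : ℝ) ≤ d := by exact_mod_cast hd
  have h1 : (d : ℝ) - 1 ≠ 0 := by linarith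
  have h2 : (d : ℝ) - 2 ≠ 0 := by linarith
  have hs := h.symm.self_of_nhds
  simp only [weyl, riemann, curvature_eq_curvOp h, hE, scalar_of_einstein h hE, weylOp]
  simp only [sub_apply, smul_apply, ContinuousLinearMap.smulRight_apply, map_sub, map_smul,
    smul_eq_mul]
  rw [hs a c, hs a e, hs b c, hs b e]
  field_simp
  ring

/-- The constant-curvature part has Ricci trace (d−1)K g = Λg, which is already the whole Ricci
tensor. -/
lemma trace_weylOp_of_einstein (hd : 4 ≤ d) (h : IsPseudoMetricAt G x) {Λ : ℝ}
    (hE : ∀ v w, ricci G x v w = Λ * G x v w) {v w : EuclideanSpace ℝ (Fin d)}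
    {T : EuclideanSpace ℝ (Fin d) →L[ℝ] EuclideanSpace ℝ (Fin d)}
    (hT : ∀ u, T u = weylOp G (christoffelCLM G) (Λ / (d - 1)) x u v w) : traceCLM _ T = 0 := by
  have hd' : (4 : ℝ) ≤ d := by exact_mod_cast hd
  have h1 : (d : ℝ) - 1 ≠ 0 := by linarith
  have := ricci_eq_trace h (v := v) (w := w) (T := T + (Λ / (d - 1)) •
    (G x v w • ContinuousLinearMap.id ℝ _ - ((G x).flip w).smulRight v)) (by
      intro u; simp [hT, weylOp])
  rw [hE, map_add, map_smul, map_sub, map_smul, traceCLM_smulRight] at this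
  have e : traceCLM (EuclideanSpace ℝ (Fin d)) (ContinuousLinearMap.id ℝ _) = d := by
    rw [traceCLM_apply]
    simp
  rw [e] at this
  simp only [smul_eq_mul, ContinuousLinearMap.flip_apply] at this
  field_simp at this
  linarith

end CoordMetric

/-! ### Linear algebra of null frames -/

namespace IsNullFrame

variable {d : ℕ} {E : Type*} [NormedAddCommGroup E] [NormedSpace ℝ E]
  {B : E →L[ℝ] E →L[ℝ] ℝ} {ℓ n : E} {m : Fin (d - 2) → E}

lemma linearIndependent (h : IsNullFrame B ℓ n m) (hsym : ∀ a b, B a b = B b a) :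
    LinearIndependent ℝ (Sum.elim ![ℓ, n] m) := by
  rw [Fintype.linearIndependent_iff]
  intro c hc
  simp only [Fintype.sum_sum_type, Sum.elim_inl, Sum.elim_inr, Fin.sum_univ_two,
    Matrix.cons_val_zero, Matrix.cons_val_one] at hc
  have h1 := congrArg (B ℓ) hc
  have h2 := congrArg (B n) hc
  have h3 := fun i => congrArg (B (m i)) hc
  simp only [map_add, map_smul, map_sum, map_zero, h.ell_ell, h.ell_n, h.ell_m, hsym n ℓ, h.n_n,
    h.n_m, smul_eq_mul, hsym (m _) ℓ, hsym (m _) n, h.m_m] at h1 h2 h3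
  rintro (i | i)
  · fin_cases i
    · simpa using h2
    · simpa using h1
  · simpa using h3 i

lemma expand (h : IsNullFrame B ℓ n m) (hsym : ∀ a b, B a b = B b a) (hd : 2 ≤ d)
    (hE : Module.finrank ℝ E = d) (v : E) :
    v = B v n • ℓ + B v ℓ • n + ∑ i, B v (m i) • m i := by
  have hcard : Fintype.card (Fin 2 ⊕ Fin (d - 2)) = Module.finrank ℝ E := by
    simp [hE]; omega
  let b := basisOfLinearIndependentOfCardEqFinrank (h.linearIndependent hsym) hcard
  have hb : ∀ i, b i = Sum.elim ![ℓ, n] m i := fun i => by simp [b]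
  let Φ : E →ₗ[ℝ] E := ((B.flip n).smulRight ℓ + (B.flip ℓ).smulRight n
    + ∑ i, (B.flip (m i)).smulRight (m i) : E →L[ℝ] E)
  have : LinearMap.id = Φ := by
    refine b.ext fun i => ?_
    rw [hb]
    rcases i with i | i
    · fin_cases i
      · simp [Φ, h.ell_ell, h.ell_n, h.ell_m]
      · simp [Φ, h.n_n, hsym n ℓ, h.ell_n, h.n_m]
    · simp [Φ, hsym (m _) ℓ, hsym (m _) n, h.n_m, h.ell_m, h.m_m]
  have := congrArg (fun T => T v) this
  simpa [Φ, _root_.sum_apply] using this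

lemma ext_zero (h : IsNullFrame B ℓ n m) (hsym : ∀ a b, B a b = B b a) (hd : 2 ≤ d)
    (hE : Module.finrank ℝ E = d) {F : Type*} [AddCommMonoid F] [Module ℝ F] (f : E →ₗ[ℝ] F)
    (h1 : f ℓ = 0) (h2 : f n = 0) (h3 : ∀ i, f (m i) = 0) : f = 0 := by
  ext v
  rw [h.expand hsym hd hE v]
  simp [h1, h2, h3]

lemma perp_ext_zero (h : IsNullFrame B ℓ n m) (hsym : ∀ a b, B a b = B b a) (hd : 2 ≤ d)
    (hE : Module.finrank ℝ E = d) {F : Type*} [AddCommMonoid F] [Module ℝ F] (f : E →ₗ[ℝ] F)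
    (h1 : f ℓ = 0) (h3 : ∀ i, f (m i) = 0) {v : E} (hv : B ℓ v = 0) : f v = 0 := by
  rw [h.expand hsym hd hE v]
  simp [h1, h3, hsym v, hv]

lemma trace_eq [FiniteDimensional ℝ E] (h : IsNullFrame B ℓ n m) (hsym : ∀ a b, B a b = B b a) (hd : 2 ≤ d)
    (hE : Module.finrank ℝ E = d) (T : E →L[ℝ] E) :
    traceCLM E T = B (T ℓ) n + B (T n) ℓ + ∑ i, B (T (m i)) (m i) := by
  have : T = ((B.flip n).comp T).smulRight ℓ + ((B.flip ℓ).comp T).smulRight n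
    + ∑ i, ((B.flip (m i)).comp T).smulRight (m i) := by
    ext v
    simpa [_root_.sum_apply] using h.expand hsym hd hE (T v)
  conv_lhs => rw [this]
  simp [traceCLM_smulRight]

/-- A vector orthogonal to the whole frame has zero coefficients in it. The frames supplied by type
N alignment thus make the metric nondegenerate. -/
lemma isInvertible [FiniteDimensional ℝ E] (h : IsNullFrame B ℓ n m) (hsym : ∀ a b, B a b = B b a) (hd : 2 ≤ d)
    (hE : Module.finrank ℝ E = d) : B.IsInvertible := by
  have hinj : Function.Injective B := by
    rw [injective_iff_map_eq_zero]
    intro v hv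
    rw [h.expand hsym hd hE v]
    simp [hv]
  let f : E →ₗ[ℝ] (E →L[ℝ] ℝ) := B
  have hfin : Module.finrank ℝ E = Module.finrank ℝ (E →L[ℝ] ℝ) := by
    rw [← (LinearMap.toContinuousLinearMap : (E →ₗ[ℝ] ℝ) ≃ₗ[ℝ] E →L[ℝ] ℝ).finrank_eq]
    exact (Subspace.dual_finrank_eq).symm
  refine ⟨(LinearEquiv.ofInjectiveOfFinrankEq f hinj hfin).toContinuousLinearEquiv, ?_⟩
  ext v w
  rfl

end IsNullFrame

/-! ### Type N tensors and the algebra left by the Bianchi identities -/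

section CurvatureLike

variable {d : ℕ} {E : Type*} [NormedAddCommGroup E] [NormedSpace ℝ E]

/-- The algebraic symmetries of the Riemann tensor. -/
structure IsCurvatureLike (Q : E →ₗ[ℝ] E →ₗ[ℝ] E →ₗ[ℝ] E →ₗ[ℝ] ℝ) : Prop where
  skew_left : ∀ a b c e, Q a b c e = -Q b a c e
  skew_right : ∀ a b c e, Q a b c e = -Q a b e c
  cyclic : ∀ a b c e, Q a b c e + Q b c a e + Q c a b e = 0

lemma IsCurvatureLike.pair_symm {Q : E →ₗ[ℝ] E →ₗ[ℝ] E →ₗ[ℝ] E →ₗ[ℝ] ℝ} (h : IsCurvatureLike Q)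
    (a b c e : E) : Q a b c e = Q c e a b := by
  have h1 := h.cyclic a b c e
  have h2 := h.cyclic b c e a
  have h3 := h.cyclic c e a b
  have h4 := h.cyclic e a b c
  have s := h.skew_left
  have t := h.skew_right
  linarith [t b c a e, t c a b e, s c a e b, t e b c a, s e b a c, t c e b a, t e a c b, t a b e c,
    s c e b a, t c e a b, t e a b c, t b e c a, s b e a c, t a c b e, s a c e b, t a c e b,
    t b e a c, s b e c a, s e b c a]

/-- The algebraic form of a tensor of type N with respect to the null vector `ℓ`. -/
structure IsTypeN (B : E →L[ℝ] E →L[ℝ] ℝ) (ℓ : E)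
    (Q : E →ₗ[ℝ] E →ₗ[ℝ] E →ₗ[ℝ] E →ₗ[ℝ] ℝ) : Prop where
  ell : ∀ b c e, Q ℓ b c e = 0
  wedge : ∀ u v w a b, B ℓ u * Q v w a b + B ℓ v * Q w u a b + B ℓ w * Q u v a b = 0

variable {B : E →L[ℝ] E →L[ℝ] ℝ} {ℓ n : E} {m : Fin (d - 2) → E}
  {Q : E →ₗ[ℝ] E →ₗ[ℝ] E →ₗ[ℝ] E →ₗ[ℝ] ℝ}

/-- The vanishing components and the symmetries show that Q vanishes on ℓ and on pairs from ℓ^⊥.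
Splitting off n-components exhibits Q as ℓ♭ wedged with Q(n, ·), whence ℓ♭ ∧ Q = 0. Both conclusions
are independent of the frame and can be differentiated. -/
lemma isTypeN_of_frame (h : IsNullFrame B ℓ n m) (hsym : ∀ a b, B a b = B b a) (hd : 2 ≤ d)
    (hE : Module.finrank ℝ E = d) (hQ : IsCurvatureLike Q)
    (C0i0j : ∀ i j, Q ℓ (m i) ℓ (m j) = 0) (C0ijk : ∀ i j k, Q ℓ (m i) (m j) (m k) = 0)
    (C010i : ∀ i, Q ℓ n ℓ (m i) = 0) (Cijkl : ∀ i j k l, Q (m i) (m j) (m k) (m l) = 0)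
    (C0i1j : ∀ i j, Q ℓ (m i) n (m j) = 0) (C01ij : ∀ i j, Q ℓ n (m i) (m j) = 0)
    (C0101 : Q ℓ n ℓ n = 0) (C1ijk : ∀ i j k, Q n (m i) (m j) (m k) = 0)
    (C101i : ∀ i, Q n ℓ n (m i) = 0) : IsTypeN B ℓ Q := by
  have s0 : ∀ a, Q a a = 0 := fun a => by
    ext c e; have := hQ.skew_left a a c e; simp; linarith
  have t0 : ∀ a b c, Q a b c c = 0 := fun a b c => by
    have := hQ.skew_right a b c c; linarith
  have t := hQ.skew_right
  have s := hQ.skew_left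
  have ps := hQ.pair_symm
  have X := fun f => h.ext_zero hsym hd hE (F := ℝ) f
  have X1 := fun f => h.ext_zero hsym hd hE (F := E →ₗ[ℝ] ℝ) f
  have X2 := fun f => h.ext_zero hsym hd hE (F := E →ₗ[ℝ] E →ₗ[ℝ] ℝ) f
  have hℓ : Q ℓ = 0 := by
    refine X2 _ (s0 ℓ) (X1 _ (X _ (t0 _ _ _) C0101 C010i) (X _ ?_ (t0 _ _ _) ?_)
      fun i => X _ ?_ ?_ (C01ij i)) fun i => X1 _ (X _ (t0 _ _ _) ?_ (C0i0j i))
      (X _ ?_ (t0 _ _ _) (C0i1j i)) fun j => X _ ?_ ?_ (C0ijk i j)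
    · rw [t, C0101, neg_zero]
    · intro i; rw [s, C101i, neg_zero]
    · rw [t, C010i, neg_zero]
    · rw [t, s, C101i, neg_zero, neg_zero]
    · rw [ps, C010i]
    · rw [t, ps, C010i, neg_zero]
    · rw [t, C0i0j, neg_zero]
    · rw [t, C0i1j, neg_zero]
  have hℓ' : ∀ b c e, Q ℓ b c e = 0 := by simp [hℓ]
  have hℓ2 : ∀ b, Q b ℓ = 0 := fun b => by ext c e; rw [s, hℓ']; simp
  have hmm : ∀ i j, Q (m i) (m j) = 0 := fun i j => by
    refine X1 _ ?_ (X _ ?_ (t0 _ _ _) ?_) fun k => X _ ?_ ?_ (Cijkl i j k)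
    · ext e; rw [ps, hℓ']; simp
    · rw [t, ps, hℓ', neg_zero]
    · intro k; rw [ps, C1ijk]
    · rw [t, ps, hℓ', neg_zero]
    · rw [t, ps, C1ijk, neg_zero]
  have hperp : ∀ a b, B ℓ a = 0 → B ℓ b = 0 → Q a b = 0 := by
    intro a b ha hb
    refine h.perp_ext_zero hsym hd hE (Q.flip b) (by simp [hℓ]) (fun i => ?_) ha
    exact h.perp_ext_zero hsym hd hE (Q (m i)) (hℓ2 _) (hmm i) hb
  have form : ∀ c e a b, Q c e a b = B ℓ c * Q n e a b - B ℓ e * Q n c a b := by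
    intro c e a b
    have := hperp (c - B ℓ c • n) (e - B ℓ e • n) (by simp [h.ell_n]) (by simp [h.ell_n])
    have := congrArg (fun T => T a b) this
    simp only [map_sub, map_smul, LinearMap.sub_apply, LinearMap.smul_apply, smul_eq_mul,
      LinearMap.zero_apply, s0, mul_zero, sub_zero] at this
    rw [s c n] at this
    linarith
  refine ⟨hℓ', fun u v w a b => ?_⟩
  rw [form v w, form w u, form u v]
  ring

namespace IsTypeN

lemma perp (h : IsTypeN B ℓ Q) (hn : B ℓ n = 1) {a b : E} (ha : B ℓ a = 0) (hb : B ℓ b = 0)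
    (c e : E) : Q a b c e = 0 := by
  simpa [hn, ha, hb] using h.wedge n a b c e

/-- The factorisation through ℓ♭ in each index pair leaves only the matrix Ψ, so Ψ = 0 would give Q
= 0. -/
lemma exists_ne_zero (hN : IsTypeN B ℓ Q) (h : IsNullFrame B ℓ n m)
    (hsym : ∀ a b, B a b = B b a) (hd : 2 ≤ d)
    (hE : Module.finrank ℝ E = d) (hQ : IsCurvatureLike Q) (h0 : Q ≠ 0) :
    ∃ i j, Q n (m i) n (m j) ≠ 0 := by
  by_contra! hc
  apply h0
  have s := hQ.skew_left
  have t := hQ.skew_right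
  have ps := hQ.pair_symm
  have s0 : ∀ a c e, Q a a c e = 0 := fun a c e => by
    have := hQ.skew_left a a c e; linarith
  have t0 : ∀ a b c, Q a b c c = 0 := fun a b c => by
    have := hQ.skew_right a b c c; linarith
  have form : ∀ c e a b, Q c e a b = B ℓ c * Q n e a b - B ℓ e * Q n c a b := by
    intro c e a b
    have := hN.wedge n c e a b
    rw [h.ell_n, s e n] at this
    linarith
  have h1 : ∀ i, Q n (m i) n = 0 := fun i => by
    refine h.ext_zero hsym hd hE _ ?_ (t0 _ _ _) (hc i)
    rw [t, ps, hN.ell, neg_zero]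
  have h2 : ∀ i, Q n (m i) = 0 := fun i => by
    ext a b
    rw [ps, form, ps n b, ps n a]
    simp [h1]
  have h3 : Q n = 0 := by
    refine h.ext_zero hsym hd hE _ ?_ ?_ h2
    · ext a b; rw [s, hN.ell]; simp
    · ext a b; rw [s0]; simp
  ext c e a b
  rw [form, h3]
  simp

end IsTypeN

/-- The pointwise consequences of the Bianchi identities for a curvature tensor `Q` of type N with
null vector `ℓ`, where `L` is the endomorphism `u ↦ ∇_u ℓ`. -/
structure IsTypeNOptical (B : E →L[ℝ] E →L[ℝ] ℝ) (ℓ : E)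
    (Q : E →ₗ[ℝ] E →ₗ[ℝ] E →ₗ[ℝ] E →ₗ[ℝ] ℝ) (L : E →L[ℝ] E) : Prop where
  symm : ∀ a b, B a b = B b a
  curvatureLike : IsCurvatureLike Q
  typeN : IsTypeN B ℓ Q
  perp : ∀ u, B ℓ (L u) = 0
  cyclic : ∀ u v w a, Q v w (L u) a + Q w u (L v) a + Q u v (L w) a = 0
  optical : ∀ n a b, B ℓ n = 1 → B ℓ a = 0 → B ℓ b = 0 → ∀ u v w,
    (B (L u) a * Q v w b n + B (L u) b * Q v w n a)
      + (B (L v) a * Q w u b n + B (L v) b * Q w u n a)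
      + (B (L w) a * Q u v b n + B (L w) b * Q u v n a) = 0

namespace IsTypeNOptical

variable {L : E →L[ℝ] E}

lemma psi_comm (H : IsTypeNOptical B ℓ Q L) (hn : B ℓ n = 1) {a b : E} (ha : B ℓ a = 0)
    (hb : B ℓ b = 0) : Q n b n (L a) = Q n a n (L b) := by
  have := H.cyclic n a b n
  rw [H.typeN.perp hn ha hb, H.curvatureLike.skew_left b n, H.curvatureLike.skew_right n b,
    H.curvatureLike.skew_right n a] at this
  linarith

/-- The cyclic relation on (n, a, ℓ): κ lies in the kernel of Ψ. -/
lemma psi_geodesic (H : IsTypeNOptical B ℓ Q L) (a : E) : Q n a n (L ℓ) = 0 := by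
  have := H.cyclic n a ℓ n
  rw [H.curvatureLike.skew_left a ℓ, H.typeN.ell, H.typeN.ell,
    H.curvatureLike.skew_right n a] at this
  linarith

lemma psi_wedge_geodesic (H : IsTypeNOptical B ℓ Q L) (hn : B ℓ n = 1) {a b : E} (ha : B ℓ a = 0)
    (hb : B ℓ b = 0) (c : E) : B (L ℓ) a * Q n c n b = B (L ℓ) b * Q n c n a := by
  have := H.optical n a b hn ha hb ℓ n c
  simp only [H.curvatureLike.skew_left c ℓ, H.typeN.ell, H.curvatureLike.skew_right n c b n] at this
  linarith

lemma psi_wedge (H : IsTypeNOptical B ℓ Q L) (hn : B ℓ n = 1) {u v a b : E} (hu : B ℓ u = 0)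
    (hv : B ℓ v = 0) (ha : B ℓ a = 0) (hb : B ℓ b = 0) :
    B (L u) a * Q n v n b - B (L u) b * Q n v n a - B (L v) a * Q n u n b
      + B (L v) b * Q n u n a = 0 := by
  have := H.optical n a b hn ha hb n u v
  simp only [H.typeN.perp hn hu hv, H.curvatureLike.skew_left v n,
    H.curvatureLike.skew_right n v b n, H.curvatureLike.skew_right n u b n] at this
  linarith

/-- Taking b = Lℓ in κ_a Ψ_cb = κ_b Ψ_ca and using Ψκ = 0 gives |κ|²Ψ = 0. Since Lℓ is orthogonal to
ℓ, its norm is the sum of the squares of the κ_i. -/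
lemma geodesic (H : IsTypeNOptical B ℓ Q L) (hQ : Q ≠ 0)
    (h : IsNullFrame B ℓ n m) (hd : 2 ≤ d) (hE : Module.finrank ℝ E = d) (i : Fin (d - 2)) :
    B (L ℓ) (m i) = 0 := by
  obtain ⟨j, k, hjk⟩ := H.typeN.exists_ne_zero h H.symm hd hE H.curvatureLike hQ
  have h1 := H.psi_wedge_geodesic h.ell_n (h.ell_m k) (H.perp ℓ) (m j)
  rw [H.psi_geodesic, mul_zero] at h1
  have h2 : B (L ℓ) (L ℓ) = 0 := by
    rcases mul_eq_zero.1 h1.symm with h | h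
    · exact h
    · exact absurd h hjk
  have h3 := congrArg (B (L ℓ)) (h.expand H.symm hd hE (L ℓ))
  rw [h2] at h3
  simp only [map_add, map_smul, map_sum, smul_eq_mul, H.symm (L ℓ) ℓ, H.perp, mul_zero,
    zero_mul, zero_add] at h3
  have := (Finset.sum_eq_zero_iff_of_nonneg (fun i _ => mul_self_nonneg (B (L ℓ) (m i)))).1 h3.symm
    i (Finset.mem_univ i)
  simpa using this

end IsTypeNOptical

end CurvatureLike

/-! ### Normal form of the optical matrix in an eigenbasis of Ψ -/

section NormalForm

variable {k : ℕ}

lemma Matrix.IsSymm.exists_orthogonal_diagonal {A : Matrix (Fin k) (Fin k) ℝ} (hA : A.IsSymm) :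
    ∃ O ∈ Matrix.orthogonalGroup (Fin k) ℝ, ∃ p : Fin k → ℝ,
      O * A * O.transpose = Matrix.diagonal p := by
  have hH : A.IsHermitian := by rwa [Matrix.IsHermitian, Matrix.conjTranspose_eq_transpose_of_trivial]
  refine ⟨(star hH.eigenvectorUnitary : Matrix.unitaryGroup (Fin k) ℝ), SetLike.coe_mem _,
    hH.eigenvalues, ?_⟩
  have h := hH.spectral_theorem
  have hU : star (hH.eigenvectorUnitary : Matrix (Fin k) (Fin k) ℝ) * hH.eigenvectorUnitary = 1 :=
    Unitary.coe_star_mul_self _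
  have ht : (star (hH.eigenvectorUnitary : Matrix (Fin k) (Fin k) ℝ)).transpose
      = hH.eigenvectorUnitary := by
    rw [Matrix.star_eq_conjTranspose, Matrix.conjTranspose_eq_transpose_of_trivial,
      Matrix.transpose_transpose]
  rw [Unitary.conjStarAlgAut_apply] at h
  simp only [Unitary.coe_star, ht]
  refine (congrArg (fun Z => star (hH.eigenvectorUnitary : Matrix (Fin k) (Fin k) ℝ) * Z
    * hH.eigenvectorUnitary) h).trans ?_
  simp only [Matrix.mul_assoc, hU, Matrix.mul_one]
  rw [← Matrix.mul_assoc, hU, Matrix.one_mul]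
  rfl

lemma trace_typeNOpticalBlock (hk : 2 ≤ k) (r a : ℝ) : (typeNOpticalBlock k r a).trace = r := by
  obtain ⟨k, rfl⟩ := Nat.exists_eq_add_of_le' hk
  simp [Matrix.trace, typeNOpticalBlock, Fin.sum_univ_succ]

/-- A rotation may be replaced by a proper one at the price of changing the sign of `a`. -/
lemma exists_special_of_orthogonal (hk : 2 ≤ k) {ρ X : Matrix (Fin k) (Fin k) ℝ}
    (hX : X ∈ Matrix.orthogonalGroup (Fin k) ℝ) {r a : ℝ}
    (h : X * ρ * X.transpose = typeNOpticalBlock k r a) :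
    ∃ X ∈ Matrix.specialOrthogonalGroup (Fin k) ℝ, ∃ a : ℝ,
      X * ρ * X.transpose = typeNOpticalBlock k ρ.trace a := by
  have hX' := (Matrix.mem_orthogonalGroup_iff _ _).1 hX
  have hr : ρ.trace = r := by
    rw [← trace_typeNOpticalBlock hk r a, ← h, Matrix.mul_assoc, Matrix.trace_mul_comm,
      Matrix.mul_assoc, mul_eq_one_comm.1 hX', Matrix.mul_one]
  rw [hr]
  have hdet : X.det = 1 ∨ X.det = -1 := by
    have := congrArg Matrix.det hX'
    rw [Matrix.det_mul, Matrix.det_transpose, Matrix.det_one] at this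
    exact mul_self_eq_one_iff.1 this
  rcases hdet with hdet | hdet
  · exact ⟨X, Matrix.mem_specialOrthogonalGroup_iff.2 ⟨hX, hdet⟩, a, h⟩
  · obtain ⟨k, rfl⟩ := Nat.exists_eq_add_of_le' hk
    -- The reflection in the first axis has determinant −1, and conjugation by it changes only the
    -- sign of the off-diagonal entries of the block.
    let D : Matrix (Fin (k + 2)) (Fin (k + 2)) ℝ :=
      Matrix.diagonal fun i => if i = 0 then -1 else 1
    have hDt : D.transpose = D := Matrix.diagonal_transpose _
    have hDD : D * D = 1 := by
      simp only [D, Matrix.diagonal_mul_diagonal, ← Matrix.diagonal_one]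
      congr 1; ext i; split_ifs <;> simp
    have hDdet : D.det = -1 := by simp [D, Matrix.det_diagonal]
    refine ⟨D * X, Matrix.mem_specialOrthogonalGroup_iff.2 ⟨?_, ?_⟩, -a, ?_⟩
    · refine mul_mem ((Matrix.mem_orthogonalGroup_iff _ _).2 ?_) hX
      rw [hDt, hDD]
    · rw [Matrix.det_mul, hDdet, hdet]; norm_num
    · have : D * X * ρ * (D * X).transpose = D * (X * ρ * X.transpose) * D := by
        rw [Matrix.transpose_mul, hDt]; simp only [Matrix.mul_assoc]
      rw [this, h]
      ext i j
      simp only [D, Matrix.diagonal_mul, Matrix.mul_diagonal, typeNOpticalBlock, Matrix.of_apply]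
      by_cases hi : i = 0 <;> by_cases hj : j = 0
      · simp [hi, hj]
      · have : ¬ (0 = (j : ℕ)) := fun h => hj (Fin.ext h.symm)
        simp [hi, hj, this]
        split_ifs <;> simp [neg_div]
      · have : ¬ ((i : ℕ) = 0) := fun h => hi (Fin.ext h)
        simp [hi, hj, this]
        split_ifs <;> simp [neg_div]
      · have : ¬ ((j : ℕ) = 0) := fun h => hj (Fin.ext h)
        have h' : ¬ ((i : ℕ) = 0) := fun h => hi (Fin.ext h)
        simp [hi, hj, this, h']

lemma exists_perm_apply_zero_one (a b : Fin (k + 2)) (hab : a ≠ b) :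
    ∃ σ : Equiv.Perm (Fin (k + 2)), σ 0 = a ∧ σ 1 = b := by
  have h : (Equiv.swap 0 a).symm b ≠ 0 := by
    intro h
    rw [Equiv.symm_apply_eq, Equiv.swap_apply_left] at h
    exact hab h.symm
  refine ⟨(Equiv.swap 1 ((Equiv.swap 0 a).symm b)).trans (Equiv.swap 0 a), ?_, ?_⟩
  · rw [Equiv.trans_apply, Equiv.swap_apply_of_ne_of_ne (by simp) h.symm, Equiv.swap_apply_left]
  · simp

/-- The normal form of an optical matrix, in an eigenbasis of the type N Weyl tensor. -/
lemma exists_perm_normal_form {p : Fin (k + 2) → ℝ} {ρ : Matrix (Fin (k + 2)) (Fin (k + 2)) ℝ}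
    (hp : p ≠ 0) (htr : ∑ i, p i = 0) (hsym : ∀ i j, p i * ρ i j = p j * ρ j i)
    (hoff : ∀ i j l, l ≠ i → j ≠ i → j ≠ l → ρ l i * p j = 0)
    (hdiag : ∀ i j, i ≠ j → ρ i i * p j + ρ j j * p i = 0) :
    ∃ σ : Equiv.Perm (Fin (k + 2)), ∃ r a : ℝ, ρ.submatrix σ σ = typeNOpticalBlock (k + 2) r a := by
  obtain ⟨s, hs⟩ : ∃ s, p s ≠ 0 := by
    by_contra! h; exact hp (funext h)
  obtain ⟨t, hst, ht⟩ : ∃ t, s ≠ t ∧ p t ≠ 0 := by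
    by_contra! h
    rw [Finset.sum_eq_single s (fun j _ hj => h j hj.symm) (by simp)] at htr
    exact hs htr
  -- With a third non-zero eigenvalue, the diagonal relations among s, t, q force ρ_ss = 0, then
  -- every diagonal entry vanishes. Off the diagonal, one of s, t, q always avoids both indices and
  -- `hoff` applies.
  by_cases h3 : ∃ q, q ≠ s ∧ q ≠ t ∧ p q ≠ 0
  · obtain ⟨q, hqs, hqt, hq⟩ := h3
    have hss : ρ s s = 0 := by
      have e1 := hdiag s t hst
      have e2 := hdiag s q hqs.symm
      have e3 := hdiag t q hqt.symm
      have : 2 * (ρ s s * p t * p q) = 0 := by linear_combination p q * e1 + p t * e2 - p s * e3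
      simpa [ht, hq] using this
    have hd : ∀ i, ρ i i = 0 := by
      intro i
      by_cases hi : i = s
      · rw [hi, hss]
      · have := hdiag i s hi
        rw [hss, zero_mul, add_zero] at this
        simpa [hs] using this
    have ho : ∀ i l, l ≠ i → ρ l i = 0 := by
      intro i l hli
      by_cases h1 : s ≠ i ∧ s ≠ l
      · simpa [hs] using hoff i s l hli h1.1 h1.2
      by_cases h2 : t ≠ i ∧ t ≠ l
      · simpa [ht] using hoff i t l hli h2.1 h2.2
      refine (mul_eq_zero.1 (hoff i q l hli ?_ ?_)).resolve_right hq
      · rintro rfl; grind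
      · rintro rfl; grind
    refine ⟨1, 0, 0, ?_⟩
    ext i j
    have : ρ i j = 0 := by
      by_cases hij : i = j
      · rw [hij, hd]
      · exact ho j i hij
    simp [typeNOpticalBlock, this]
  · push Not at h3
    -- Exactly two eigenvalues are non-zero, and they are opposite because the trace vanishes. This
    -- makes the diagonal entries of the block equal and its off-diagonal entries opposite.
    have hpt : p t = -p s := by
      rw [Finset.sum_eq_add s t hst (fun c _ hc => h3 c hc.1 hc.2) (by simp) (by simp)] at htr
      linarith
    have htt : ρ t t = ρ s s := by
      have := hdiag s t hst
      rw [hpt] at this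
      have : (ρ t t - ρ s s) * p s = 0 := by linarith
      rcases mul_eq_zero.1 this with h | h
      · linarith
      · exact absurd h hs
    have hts : ρ t s = -ρ s t := by
      have := hsym s t
      rw [hpt] at this
      have : p s * (ρ t s + ρ s t) = 0 := by linarith
      rcases mul_eq_zero.1 this with h | h
      · exact absurd h hs
      · linarith
    obtain ⟨σ, h0, h1⟩ := exists_perm_apply_zero_one s t hst
    refine ⟨σ, 2 * ρ s s, 2 * ρ s t, ?_⟩
    have hz : ∀ i j, ¬ (i = s ∨ i = t) ∨ ¬ (j = s ∨ j = t) → ρ i j = 0 := by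
      intro i j hij
      by_cases hd : i = j
      · subst hd
        have : i ≠ s ∧ i ≠ t := by tauto
        have e := hdiag i s this.1
        rw [h3 i this.1 this.2, mul_zero, add_zero] at e
        simpa [hs] using e
      · by_cases h1 : s ≠ j ∧ s ≠ i
        · simpa [hs] using hoff j s i hd h1.1 h1.2
        · refine (mul_eq_zero.1 (hoff j t i hd ?_ ?_)).resolve_right ht
          · rintro rfl; tauto
          · rintro rfl; tauto
    have hσ : ∀ i : Fin (k + 2), 2 ≤ (i : ℕ) → ¬ (σ i = s ∨ σ i = t) := by
      intro i hi h
      rw [← h0, ← h1, σ.injective.eq_iff, σ.injective.eq_iff] at h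
      rcases h with h | h <;> simp [h] at hi
    have hcase : ∀ i : Fin (k + 2), i = 0 ∨ i = 1 ∨ 2 ≤ (i : ℕ) := by
      intro i
      simp only [Fin.ext_iff, Fin.val_zero, Fin.val_one]
      omega
    ext i j
    simp only [Matrix.submatrix_apply, typeNOpticalBlock, Matrix.of_apply]
    rcases hcase i with rfl | rfl | hi
    · rcases hcase j with rfl | rfl | hj
      · simp [h0]
      · simp [h0, h1]
      · rw [hz _ _ (Or.inr (hσ j hj))]
        have e1 : ¬ (0 = (j : ℕ)) := by omega
        have e2 : ¬ ((j : ℕ) = 1) := by omega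
        simp [e1, e2]
    · rcases hcase j with rfl | rfl | hj
      · simp [h0, h1, hts]
        ring
      · simp [h1, htt]
      · rw [hz _ _ (Or.inr (hσ j hj))]
        have e1 : ¬ (1 = (j : ℕ)) := by omega
        have e2 : ¬ ((j : ℕ) = 0) := by omega
        simp [e1, e2]
    · rw [hz _ _ (Or.inl (hσ i hi))]
      have e1 : ¬ ((i : ℕ) = 0) := by omega
      have e2 : ¬ ((i : ℕ) = 1) := by omega
      have e3 : ¬ ((i : ℕ) < 2) := by omega
      simp [e1, e2, e3]

/-- The hypotheses are invariant under simultaneous rotation of Ψ and ρ, so Ψ may be taken diagonal.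
Evaluating `hw` on rows of the rotation gives the entrywise relations of `exists_perm_normal_form`.
-/
theorem optical_normal_form (hk : 2 ≤ k) {Ψ ρ : Matrix (Fin k) (Fin k) ℝ} (hΨ : Ψ.IsSymm)
    (h0 : Ψ ≠ 0) (htr : Ψ.trace = 0) (hsym : (Ψ * ρ).IsSymm)
    (hw : ∀ u v a b : Fin k → ℝ,
      (a ⬝ᵥ ρ.mulVec u) * (v ⬝ᵥ Ψ.mulVec b) - (b ⬝ᵥ ρ.mulVec u) * (v ⬝ᵥ Ψ.mulVec a)
      - (a ⬝ᵥ ρ.mulVec v) * (u ⬝ᵥ Ψ.mulVec b) + (b ⬝ᵥ ρ.mulVec v) * (u ⬝ᵥ Ψ.mulVec a) = 0) :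
    ∃ X ∈ Matrix.specialOrthogonalGroup (Fin k) ℝ, ∃ a : ℝ,
      X * ρ * X.transpose = typeNOpticalBlock k ρ.trace a := by
  obtain ⟨O, hO, p, hp⟩ := hΨ.exists_orthogonal_diagonal
  have hO' := (Matrix.mem_orthogonalGroup_iff _ _).1 hO
  have hO'' := mul_eq_one_comm.1 hO'
  have hΨ' : Ψ = O.transpose * Matrix.diagonal p * O := by
    rw [← hp]
    simp only [Matrix.mul_assoc, hO'', Matrix.mul_one]
    rw [← Matrix.mul_assoc, hO'', Matrix.one_mul]
  set R := O * ρ * O.transpose with hR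
  have hRe : ∀ i j, R i j = O i ⬝ᵥ ρ.mulVec (O j) := fun i j => by
    rw [hR, Matrix.mul_mul_apply, Matrix.transpose_transpose]
  have hPe : ∀ i j, Matrix.diagonal p i j = O i ⬝ᵥ Ψ.mulVec (O j) := fun i j => by
    rw [← hp, Matrix.mul_mul_apply, Matrix.transpose_transpose]
  have hw' : ∀ i j l q, R l i * Matrix.diagonal p j q - R q i * Matrix.diagonal p j l
      - R l j * Matrix.diagonal p i q + R q j * Matrix.diagonal p i l = 0 := by
    intro i j l q
    simp only [hRe, hPe]
    exact hw _ _ _ _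
  have hsym' : (Matrix.diagonal p * R).IsSymm := by
    have : Matrix.diagonal p * R = O * (Ψ * ρ) * O.transpose := by
      rw [← hp, hR]
      simp only [Matrix.mul_assoc]
      rw [← Matrix.mul_assoc O.transpose O, hO'', Matrix.one_mul]
    rw [this, Matrix.IsSymm, Matrix.transpose_mul, Matrix.transpose_mul, hsym.eq,
      Matrix.transpose_transpose]
    simp only [Matrix.mul_assoc]
  obtain ⟨k, rfl⟩ := Nat.exists_eq_add_of_le' hk
  obtain ⟨σ, r, a, hσ⟩ := exists_perm_normal_form (p := p) (ρ := R)
    (by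
      rintro rfl
      apply h0
      rw [hΨ']
      have : Matrix.diagonal (0 : Fin (k + 2) → ℝ) = 0 := Matrix.diagonal_zero
      rw [this, Matrix.mul_zero, Matrix.zero_mul])
    (by
      rw [← Matrix.trace_diagonal, ← hp, Matrix.mul_assoc, Matrix.trace_mul_comm, Matrix.mul_assoc,
        hO'', Matrix.mul_one, htr])
    (fun i j => by
      have := congrFun (congrFun hsym' j) i
      simpa [Matrix.diagonal_mul] using this)
    (fun i j l hli hji hjl => by
      have := hw' i j l j
      simpa [hji, hjl, hji.symm, hli.symm] using this)
    (fun i j hij => by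
      have := hw' i j i j
      simpa [hij, hij.symm] using this)
  refine exists_special_of_orthogonal hk (X := O.submatrix σ id) (r := r) (a := a) ?_ ?_
  · rw [Matrix.mem_orthogonalGroup_iff, Matrix.transpose_submatrix,
      ← Matrix.submatrix_mul _ _ _ _ _ Function.bijective_id, hO', Matrix.submatrix_one_equiv]
  · rw [← hσ, hR, Matrix.transpose_submatrix]
    rfl

end NormalForm

/-! ### The optical matrix and its traces in a null frame -/

namespace IsTypeNOptical

variable {d : ℕ} {E : Type*} [NormedAddCommGroup E] [NormedSpace ℝ E]
  {B : E →L[ℝ] E →L[ℝ] ℝ} {ℓ n : E} {m : Fin (d - 2) → E}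
  {Q : E →ₗ[ℝ] E →ₗ[ℝ] E →ₗ[ℝ] E →ₗ[ℝ] ℝ} {L : E →L[ℝ] E}

/-- The optical matrix of `ℓ`, where `L` is the endomorphism `u ↦ ∇_u ℓ`. -/
noncomputable def _root_.opticalOf {k : ℕ} (B : E →L[ℝ] E →L[ℝ] ℝ) (L : E →L[ℝ] E) (m : Fin k → E) :
    Matrix (Fin k) (Fin k) ℝ :=
  Matrix.of fun i j => B (m i) (L (m j))

lemma _root_.opticalOf_rotate {k : ℕ} (m : Fin k → E) (Y : Matrix (Fin k) (Fin k) ℝ) :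
    opticalOf B L (fun i => ∑ j, Y i j • m j) = Y * opticalOf B L m * Y.transpose := by
  ext i j
  simp only [opticalOf, Matrix.of_apply, map_sum, map_smul, _root_.sum_apply, smul_apply,
    smul_eq_mul, Matrix.mul_apply, Matrix.transpose_apply, Finset.sum_mul]
  refine Finset.sum_congr rfl fun a _ => ?_
  rw [Finset.mul_sum]
  exact Finset.sum_congr rfl fun b _ => by ring

lemma exists_normal_form (H : IsTypeNOptical B ℓ Q L) (hQ : Q ≠ 0)
    (h : IsNullFrame B ℓ n m) (hd : 4 ≤ d) (hE : Module.finrank ℝ E = d)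
    (htr : ∑ i, Q (m i) n n (m i) = 0) :
    ∃ X ∈ Matrix.specialOrthogonalGroup (Fin (d - 2)) ℝ, ∃ a : ℝ,
      X * opticalOf B L m * X.transpose
        = typeNOpticalBlock (d - 2) (opticalOf B L m).trace a := by
  let Ψ : Matrix (Fin (d - 2)) (Fin (d - 2)) ℝ := Matrix.of fun i j => Q n (m i) n (m j)
  have hv : ∀ u : Fin (d - 2) → ℝ, B ℓ (∑ i, u i • m i) = 0 := fun u => by simp [h.ell_m]
  have hLv : ∀ i, L (m i) = B (L (m i)) n • ℓ + ∑ j, B (L (m i)) (m j) • m j := fun i => by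
    have := h.expand H.symm (by omega) hE (L (m i))
    rwa [H.symm _ ℓ, H.perp, zero_smul, add_zero] at this
  have hell : ∀ a, Q n a n ℓ = 0 := fun a => by
    rw [H.curvatureLike.skew_right, H.curvatureLike.pair_symm, H.typeN.ell, neg_zero]
  refine optical_normal_form (by omega) (Ψ := Ψ) ?_ ?_ ?_ ?_ ?_
  · ext i j
    exact H.curvatureLike.pair_symm _ _ _ _
  · obtain ⟨i, j, hij⟩ := H.typeN.exists_ne_zero h H.symm (by omega) hE H.curvatureLike hQ
    intro h0
    exact hij (congrFun (congrFun h0 i) j)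
  · rw [← neg_eq_zero, ← htr, Matrix.trace, ← Finset.sum_neg_distrib]
    exact Finset.sum_congr rfl fun i _ => (H.curvatureLike.skew_left _ _ _ _).symm
  -- The ℓ-component of `L (m j)` is invisible to Q and its n-component vanishes, so symmetry of Ψρ
  -- is `psi_comm`.
  · have key : ∀ i j, (Ψ * opticalOf B L m) i j = Q n (m i) n (L (m j)) := fun i j => by
      rw [hLv j]
      simp only [map_add, map_smul, map_sum, hell, mul_zero, zero_add, Matrix.mul_apply, Ψ,
        opticalOf, Matrix.of_apply, smul_eq_mul]
      exact Finset.sum_congr rfl fun k _ => by rw [H.symm (m k)]; ring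
    ext i j
    rw [Matrix.transpose_apply, key, key]
    exact H.psi_comm h.ell_n (h.ell_m i) (h.ell_m j)
  · intro u v a b
    have e1 : ∀ a u : Fin (d - 2) → ℝ, a ⬝ᵥ (opticalOf B L m).mulVec u
        = B (L (∑ i, u i • m i)) (∑ i, a i • m i) := fun a u => by
      rw [H.symm]
      simp only [dotProduct, Matrix.mulVec, opticalOf, Matrix.of_apply, map_sum, map_smul,
        _root_.sum_apply, smul_apply, smul_eq_mul, Finset.mul_sum]
      rw [Finset.sum_comm]
      exact Finset.sum_congr rfl fun i _ => Finset.sum_congr rfl fun j _ => by ring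
    have e2 : ∀ a u : Fin (d - 2) → ℝ, a ⬝ᵥ Ψ.mulVec u
        = Q n (∑ i, a i • m i) n (∑ i, u i • m i) := fun a u => by
      simp only [dotProduct, Matrix.mulVec, Ψ, Matrix.of_apply, map_sum, map_smul,
        LinearMap.sum_apply, LinearMap.smul_apply, smul_eq_mul, Finset.mul_sum]
      rw [Finset.sum_comm]
      exact Finset.sum_congr rfl fun i _ => Finset.sum_congr rfl fun j _ => by ring
    simp only [e1, e2]
    exact H.psi_wedge h.ell_n (hv u) (hv v) (hv a) (hv b)

/-- The traces of `L` and `L²`, when `ℓ` is geodesic. -/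
lemma trace_eq_of_geodesic [FiniteDimensional ℝ E] (H : IsTypeNOptical B ℓ Q L)
    (h : IsNullFrame B ℓ n m) (hd : 2 ≤ d) (hE : Module.finrank ℝ E = d)
    (hκ : ∀ i, B (L ℓ) (m i) = 0) :
    L ℓ = B (L ℓ) n • ℓ ∧ traceCLM E L = B (L ℓ) n + (opticalOf B L m).trace ∧
      traceCLM E (L.comp L) = B (L ℓ) n ^ 2 + (opticalOf B L m * opticalOf B L m).trace := by
  have hL : L ℓ = B (L ℓ) n • ℓ := by
    conv_lhs => rw [h.expand H.symm hd hE (L ℓ)]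
    simp [hκ, H.symm _ ℓ, H.perp]
  -- L preserves the flag ⟨ℓ⟩ ⊂ ℓ^⊥ ⊂ E and acts on the successive quotients by `B (L ℓ) n`, the
  -- optical matrix and 0.
  refine ⟨hL, ?_, ?_⟩
  · rw [h.trace_eq H.symm hd hE, H.symm _ ℓ, H.perp, add_zero]
    congr 1
    exact Finset.sum_congr rfl fun i _ => H.symm _ _
  · rw [h.trace_eq H.symm hd hE, H.symm _ ℓ, ContinuousLinearMap.comp_apply,
      ContinuousLinearMap.comp_apply, H.perp, add_zero]
    congr 1
    · rw [hL]; simp [sq, h.ell_n]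
    · refine Finset.sum_congr rfl fun i _ => ?_
      rw [Matrix.diag_apply, Matrix.mul_apply, ContinuousLinearMap.comp_apply, H.symm]
      conv_lhs => rw [h.expand H.symm hd hE (L (m i))]
      simp only [map_add, map_smul, map_sum, H.symm _ ℓ, H.perp, H.symm (m i) (L ℓ), hκ,
        mul_zero, zero_smul, zero_add, opticalOf, Matrix.of_apply, smul_eq_mul, add_zero,
        H.symm (L (m i)) (m _)]
      exact Finset.sum_congr rfl fun i _ => by ring

end IsTypeNOptical

/-! ### The Weyl operator as a 4-linear form -/

section WeylForm

variable {E : Type*} [NormedAddCommGroup E] [NormedSpace ℝ E]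

/-- The tensor `(c, e, b, a) ↦ G(W(c, e) b, a)`, where `W` is `weylOp`. -/
noncomputable def weylForm (G : E → E →L[ℝ] E →L[ℝ] ℝ) (Γ : E → E →L[ℝ] E →L[ℝ] E) (K : ℝ)
    (x : E) : E →ₗ[ℝ] E →ₗ[ℝ] E →ₗ[ℝ] E →ₗ[ℝ] ℝ :=
  LinearMap.mk₂ ℝ
    (fun c e => (ContinuousLinearMap.coeLM ℝ).comp ((G x).comp (weylOp G Γ K x c e)).toLinearMap)
    (fun c c' e => by ext b a; simp [weylOp, curvOp]; ring)
    (fun r c e => by ext b a; simp [weylOp, curvOp]; ring)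
    (fun c e e' => by ext b a; simp [weylOp, curvOp]; ring)
    (fun r c e => by ext b a; simp [weylOp, curvOp]; ring)

lemma weylForm_apply (G : E → E →L[ℝ] E →L[ℝ] ℝ) (Γ : E → E →L[ℝ] E →L[ℝ] E) (K : ℝ)
    (x c e b a : E) : weylForm G Γ K x c e b a = G x (weylOp G Γ K x c e b) a := rfl

lemma isCurvatureLike_weylForm {G : E → E →L[ℝ] E →L[ℝ] ℝ} {Γ : E → E →L[ℝ] E →L[ℝ] E} {K : ℝ}
    {x : E} (hG : ContDiffAt ℝ ∞ G x) (hΓ : ContDiffAt ℝ ∞ Γ x) (hm : IsMetricAt G Γ x)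
    (hs : IsTorsionFreeAt Γ x) (hsym : ∀ a b, G x a b = G x b a) :
    IsCurvatureLike (weylForm G Γ K x) where
  skew_left a b c e := by simp only [weylForm_apply]; rw [weylOp_swap]; simp
  skew_right a b c e := by
    have := weylOp_skew (K := K) hG hΓ hm hsym a b c e
    simp only [weylForm_apply]
    rw [hsym c] at this
    linarith
  cyclic a b c e := by
    have := congrArg (fun z => G x z e) (weylOp_cyclic (K := K) hΓ hs hsym a b c)
    simpa [weylForm_apply] using this

end WeylForm

/-! ### Type N Einstein metrics on an open set of coordinate space -/

namespace CoordMetric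

variable {d : ℕ} {G : EuclideanSpace ℝ (Fin d) →
      EuclideanSpace ℝ (Fin d) →L[ℝ] EuclideanSpace ℝ (Fin d) →L[ℝ] ℝ}
  {X : EuclideanSpace ℝ (Fin d) → EuclideanSpace ℝ (Fin d)} {Λ : ℝ}
  {T : Set (EuclideanSpace ℝ (Fin d))} {x : EuclideanSpace ℝ (Fin d)}

/-- Type N alignment of the Weyl tensor in coordinates. -/
structure WeylTypeN (G : EuclideanSpace ℝ (Fin d) →
      EuclideanSpace ℝ (Fin d) →L[ℝ] EuclideanSpace ℝ (Fin d) →L[ℝ] ℝ)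
    (x ℓ n : EuclideanSpace ℝ (Fin d)) (m : Fin (d - 2) → EuclideanSpace ℝ (Fin d)) : Prop where
  C0i0j : ∀ i j, weyl G x ℓ (m i) ℓ (m j) = 0
  C0ijk : ∀ i j k, weyl G x ℓ (m i) (m j) (m k) = 0
  C010i : ∀ i, weyl G x ℓ n ℓ (m i) = 0
  Cijkl : ∀ i j k l, weyl G x (m i) (m j) (m k) (m l) = 0
  C0i1j : ∀ i j, weyl G x ℓ (m i) n (m j) = 0
  C01ij : ∀ i j, weyl G x ℓ n (m i) (m j) = 0
  C0101 : weyl G x ℓ n ℓ n = 0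
  C1ijk : ∀ i j k, weyl G x n (m i) (m j) (m k) = 0
  C101i : ∀ i, weyl G x n ℓ n (m i) = 0

/-- An Einstein metric `G` on the open set `T`, with a multiple WAND `X` of type N. -/
structure TypeNSpacetime (G : EuclideanSpace ℝ (Fin d) →
      EuclideanSpace ℝ (Fin d) →L[ℝ] EuclideanSpace ℝ (Fin d) →L[ℝ] ℝ)
    (X : EuclideanSpace ℝ (Fin d) → EuclideanSpace ℝ (Fin d)) (Λ : ℝ)
    (T : Set (EuclideanSpace ℝ (Fin d))) : Prop where
  four_le : 4 ≤ d
  isOpen : IsOpen T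
  smooth_metric : ∀ x ∈ T, ContDiffAt ℝ ∞ G x
  smooth_field : ∀ x ∈ T, ContDiffAt ℝ ∞ X x
  symm : ∀ x ∈ T, ∀ a b, G x a b = G x b a
  einstein : ∀ x ∈ T, ∀ v w, ricci G x v w = Λ * G x v w
  frame : ∀ x ∈ T, ∃ n m, IsNullFrame (G x) (X x) n m ∧ WeylTypeN G x (X x) n m

namespace TypeNSpacetime

lemma isPseudoMetricAt (h : TypeNSpacetime G X Λ T) (hx : x ∈ T) : IsPseudoMetricAt G x where
  smooth := (h.isOpen.eventually_mem hx).mono h.smooth_metric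
  symm := (h.isOpen.eventually_mem hx).mono h.symm
  invertible := (h.isOpen.eventually_mem hx).mono fun y hy => by
    obtain ⟨n, m, hf, -⟩ := h.frame y hy
    exact hf.isInvertible (h.symm y hy) (by linarith [h.four_le]) (by simp)

/-- The Weyl tensor, up to the order of its slots, as a multilinear form. -/
noncomputable abbrev _root_.CoordMetric.weylQ (G : EuclideanSpace ℝ (Fin d) →
      EuclideanSpace ℝ (Fin d) →L[ℝ] EuclideanSpace ℝ (Fin d) →L[ℝ] ℝ) (Λ : ℝ)
    (x : EuclideanSpace ℝ (Fin d)) := weylForm G (christoffelCLM G) (Λ / (d - 1)) x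

lemma weylQ_eq (h : TypeNSpacetime G X Λ T) (hx : x ∈ T) (a b c e : EuclideanSpace ℝ (Fin d)) :
    weylQ G Λ x c e b a = weyl G x a b c e := by
  rw [weyl_of_einstein h.four_le (h.isPseudoMetricAt hx) (h.einstein x hx), weylForm_apply]

lemma isCurvatureLike (h : TypeNSpacetime G X Λ T) (hx : x ∈ T) :
    IsCurvatureLike (weylQ G Λ x) :=
  have hp := h.isPseudoMetricAt hx
  isCurvatureLike_weylForm (h.smooth_metric x hx) hp.contDiffAt_christoffelCLM hp.isMetricAt
    hp.isTorsionFreeAt (h.symm x hx)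

lemma isTypeN (h : TypeNSpacetime G X Λ T) (hx : x ∈ T) :
    IsTypeN (G x) (X x) (weylQ G Λ x) := by
  obtain ⟨n, m, hf, hw⟩ := h.frame x hx
  have hQ := h.isCurvatureLike hx
  have key : ∀ a b c e, weylQ G Λ x a b c e = -weyl G x a b c e := fun a b c e => by
    rw [hQ.pair_symm, hQ.skew_right, h.weylQ_eq hx]
  refine isTypeN_of_frame hf (h.symm x hx) (by linarith [h.four_le]) (by simp) hQ ?_ ?_ ?_ ?_ ?_
    ?_ ?_ ?_ ?_ <;> intros <;> rw [key]
  · rw [hw.C0i0j, neg_zero]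
  · rw [hw.C0ijk, neg_zero]
  · rw [hw.C010i, neg_zero]
  · rw [hw.Cijkl, neg_zero]
  · rw [hw.C0i1j, neg_zero]
  · rw [hw.C01ij, neg_zero]
  · rw [hw.C0101, neg_zero]
  · rw [hw.C1ijk, neg_zero]
  · rw [hw.C101i, neg_zero]

/-- The type N identities hold on all of the open set `T`, hence may be differentiated at x. Pair
symmetry moves ℓ into the slots used by the differential lemmas. -/
lemma isTypeNOptical (h : TypeNSpacetime G X Λ T) (hx : x ∈ T) :
    IsTypeNOptical (G x) (X x) (weylQ G Λ x) (covDerivOp (christoffelCLM G) X x) := by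
  have hp := h.isPseudoMetricAt hx
  have hG := h.smooth_metric x hx
  have hΓ := hp.contDiffAt_christoffelCLM
  have hX := h.smooth_field x hx
  have hT := h.isOpen.eventually_mem hx
  refine ⟨h.symm x hx, h.isCurvatureLike hx, h.isTypeN hx, ?_, ?_, ?_⟩
  · intro u
    rw [h.symm x hx]
    refine metric_covDerivOp_self hG hp.isMetricAt hX (h.symm x hx) (hT.mono fun y hy => ?_) u
    obtain ⟨n, m, hf, -⟩ := h.frame y hy
    exact hf.ell_ell
  · intro u v w a
    have := weylOp_covDeriv_cyclic (K := Λ / (d - 1)) hG hΓ hp.isMetricAt hp.isTorsionFreeAt hX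
      (hT.mono fun y hy v w => by
        obtain ⟨e, he⟩ := (h.isPseudoMetricAt hy).invertible.self_of_nhds
        apply e.injective
        rw [map_zero]
        ext a
        have : weylQ G Λ y v w (X y) a = 0 := by
          rw [(h.isCurvatureLike hy).pair_symm, (h.isTypeN hy).ell]
        rw [weylForm_apply, ← he] at this
        exact this) u v w
    have := congrArg (fun z => G x z a) this
    simpa [weylForm_apply] using this
  · intro n a b hn ha hb u v w
    have := weylOp_optical_cyclic (K := Λ / (d - 1)) hG hΓ hp.isMetricAt hp.isTorsionFreeAt hX
      (hT.mono fun y hy a b c v w => by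
        have := (h.isTypeN hy).wedge a b c v w
        rw [(h.isCurvatureLike hy).pair_symm b c, (h.isCurvatureLike hy).pair_symm c a,
          (h.isCurvatureLike hy).pair_symm a b] at this
        exact this) (h.symm x hx) hn ha hb u v w
    exact this

/-- The trace of u ↦ W(u,n)n vanishes. Its ℓ and n terms in the null frame are zero, so the spatial
sum, which is −tr Ψ, vanishes too. -/
lemma trace_weylQ (h : TypeNSpacetime G X Λ T) (hx : x ∈ T) {n : EuclideanSpace ℝ (Fin d)}
    {m : Fin (d - 2) → EuclideanSpace ℝ (Fin d)} (hf : IsNullFrame (G x) (X x) n m) :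
    ∑ i, weylQ G Λ x (m i) n n (m i) = 0 := by
  let S : EuclideanSpace ℝ (Fin d) →L[ℝ] EuclideanSpace ℝ (Fin d) := LinearMap.toContinuousLinearMap
    { toFun := fun u => weylOp G (christoffelCLM G) (Λ / (d - 1)) x u n n
      map_add' := fun u v => by simp [weylOp, curvOp]; module
      map_smul' := fun r u => by simp [weylOp, curvOp]; module }
  have hS : ∀ u a, G x (S u) a = weylQ G Λ x u n n a := fun u a => rfl
  have := hf.trace_eq (h.symm x hx) (by linarith [h.four_le]) (by simp) S
  rw [trace_weylOp_of_einstein h.four_le (h.isPseudoMetricAt hx) (h.einstein x hx) (v := n)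
    (w := n) (fun u => rfl)] at this
  simp only [hS] at this
  rw [(h.isTypeN hx).ell, (h.isCurvatureLike hx).pair_symm n n n (X x),
    (h.isCurvatureLike hx).skew_left n (X x), (h.isTypeN hx).ell] at this
  linarith

/-- The optical matrix of the vector field `X`. -/
noncomputable abbrev _root_.CoordMetric.optical (G : EuclideanSpace ℝ (Fin d) →
      EuclideanSpace ℝ (Fin d) →L[ℝ] EuclideanSpace ℝ (Fin d) →L[ℝ] ℝ)
    (X : EuclideanSpace ℝ (Fin d) → EuclideanSpace ℝ (Fin d)) (x : EuclideanSpace ℝ (Fin d))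
    {k : ℕ} (m : Fin k → EuclideanSpace ℝ (Fin d)) :=
  opticalOf (G x) (covDerivOp (christoffelCLM G) X x) m

lemma exists_normal_form (h : TypeNSpacetime G X Λ T) (hx : x ∈ T) (hQ : weylQ G Λ x ≠ 0)
    {n : EuclideanSpace ℝ (Fin d)} {m : Fin (d - 2) → EuclideanSpace ℝ (Fin d)}
    (hf : IsNullFrame (G x) (X x) n m) :
    ∃ Y ∈ Matrix.specialOrthogonalGroup (Fin (d - 2)) ℝ, ∃ a : ℝ,
      Y * optical G X x m * Y.transpose
        = typeNOpticalBlock (d - 2) (optical G X x m).trace a :=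
  (h.isTypeNOptical hx).exists_normal_form hQ hf h.four_le (by simp) (h.trace_weylQ hx hf)

lemma eventually_weylQ_ne_zero (h : TypeNSpacetime G X Λ T) (hx : x ∈ T)
    (hQ : weylQ G Λ x ≠ 0) : ∀ᶠ y in 𝓝 x, weylQ G Λ y ≠ 0 := by
  obtain ⟨a, b, c, e, hne⟩ : ∃ a b c e, weylQ G Λ x a b c e ≠ 0 := by
    by_contra! hc
    apply hQ
    ext a b c e
    simpa using hc a b c e
  have hp := h.isPseudoMetricAt hx
  have hc : ContinuousAt (fun y => weylQ G Λ y a b c e) x :=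
    ((h.smooth_metric x hx).hasFDerivAt_of_infty.clm_apply
      ((hasFDerivAt_weylOp (h.smooth_metric x hx) hp.contDiffAt_christoffelCLM a b).1.clm_apply
      (hasFDerivAt_const c x))).clm_apply (hasFDerivAt_const e x) |>.continuousAt
  filter_upwards [hc.eventually_ne hne] with y hy h0
  apply hy
  rw [h0]; rfl

lemma continuousAt_covDerivOp (h : TypeNSpacetime G X Λ T) (hx : x ∈ T) :
    ContinuousAt (covDerivOp (christoffelCLM G) X) x := by
  obtain ⟨L', hL, -⟩ := hasFDerivAt_covDerivOp
    (h.isPseudoMetricAt hx).contDiffAt_christoffelCLM (h.smooth_field x hx)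
  exact hL.continuousAt

/-- The projection of `u` to the orthogonal complement of `X` along `n`. -/
noncomputable def _root_.CoordMetric.perpProj (G : EuclideanSpace ℝ (Fin d) →
      EuclideanSpace ℝ (Fin d) →L[ℝ] EuclideanSpace ℝ (Fin d) →L[ℝ] ℝ)
    (X : EuclideanSpace ℝ (Fin d) → EuclideanSpace ℝ (Fin d)) (n u x : EuclideanSpace ℝ (Fin d)) :
    EuclideanSpace ℝ (Fin d) := u - (G x (X x) u / G x (X x) n) • n

lemma perpProj_of_perp {n u : EuclideanSpace ℝ (Fin d)} (hu : G x (X x) u = 0) :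
    perpProj G X n u x = u := by simp [perpProj, hu]

lemma metric_perpProj {n u : EuclideanSpace ℝ (Fin d)} (hn : G x (X x) n ≠ 0) :
    G x (X x) (perpProj G X n u x) = 0 := by simp [perpProj, hn]

lemma continuousAt_metric (h : TypeNSpacetime G X Λ T) (hx : x ∈ T)
    (u : EuclideanSpace ℝ (Fin d)) : ContinuousAt (fun y => G y (X y) u) x :=
  ((h.smooth_metric x hx).continuousAt.clm_apply (h.smooth_field x hx).continuousAt).clm_apply
    continuousAt_const

lemma continuousAt_perpProj (h : TypeNSpacetime G X Λ T) (hx : x ∈ T)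
    {n : EuclideanSpace ℝ (Fin d)} (u : EuclideanSpace ℝ (Fin d)) (hn : G x (X x) n ≠ 0) :
    ContinuousAt (perpProj G X n u) x :=
  continuousAt_const.sub (((h.continuousAt_metric hx u).div (h.continuousAt_metric hx n) hn).smul
    continuousAt_const)

lemma continuousAt_optical_perpProj (h : TypeNSpacetime G X Λ T) (hx : x ∈ T)
    {n : EuclideanSpace ℝ (Fin d)} (hn : G x (X x) n ≠ 0) (u v : EuclideanSpace ℝ (Fin d)) :
    ContinuousAt (fun y => G y (perpProj G X n u y)
      (covDerivOp (christoffelCLM G) X y (perpProj G X n v y))) x :=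
  ((h.smooth_metric x hx).continuousAt.clm_apply (h.continuousAt_perpProj hx u hn)).clm_apply
    ((h.continuousAt_covDerivOp hx).clm_apply (h.continuousAt_perpProj hx v hn))

/-- At a point at which the Weyl tensor is non-zero and the expansion vanishes nearby. -/
lemma optical_eq_zero_of_weylQ_ne_zero (h : TypeNSpacetime G X Λ T) (hx : x ∈ T)
    (hQ : weylQ G Λ x ≠ 0)
    (htr : ∀ᶠ y in 𝓝 x, weylQ G Λ y ≠ 0 →
      ∃ n m, IsNullFrame (d := d) (G y) (X y) n m ∧ (optical G X y m).trace = 0)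
    {u v : EuclideanSpace ℝ (Fin d)} (hu : G x (X x) u = 0) (hv : G x (X x) v = 0) :
    G x (covDerivOp (christoffelCLM G) X x u) v = 0 := by
  have hp := h.isPseudoMetricAt hx
  have hd : 2 ≤ d := by linarith [h.four_le]
  have H := h.isTypeNOptical hx
  obtain ⟨n, m, hf, htr0⟩ := htr.self_of_nhds hQ
  have hκ := H.geodesic hQ hf hd (by simp)
  obtain ⟨-, h1, h2⟩ := H.trace_eq_of_geodesic hf hd (by simp) hκ
  -- Where the Weyl tensor is non-zero, X is geodesic and tr L is its non-affinity plus the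
  -- expansion. Zero expansion is therefore the hypothesis of `trace_sq_covDerivOp`.
  have hdiv : ∀ᶠ y in 𝓝 x, covDerivOp (christoffelCLM G) X y (X y)
      = traceCLM _ (covDerivOp (christoffelCLM G) X y) • X y := by
    filter_upwards [htr, h.eventually_weylQ_ne_zero hx hQ, h.isOpen.eventually_mem hx]
      with y hy hy0 hyT
    obtain ⟨n, m, hf, htr⟩ := hy hy0
    have H := h.isTypeNOptical hyT
    obtain ⟨h1, h2, -⟩ := H.trace_eq_of_geodesic hf hd (by simp) (H.geodesic hy0 hf hd (by simp))
    rw [htr, add_zero] at h2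
    rwa [h2]
  have hsq := trace_sq_covDerivOp hp.contDiffAt_christoffelCLM hp.isTorsionFreeAt
    (h.smooth_field x hx) hdiv (fun S hS => by
      rw [← ricci_eq_trace hp hS, h.einstein x hx, hf.ell_ell, mul_zero])
  rw [htr0, add_zero] at h1
  rw [h1, h2] at hsq
  obtain ⟨Y, hY, a, hYa⟩ := h.exists_normal_form hx hQ hf
  have hY' := (Matrix.mem_orthogonalGroup_iff _ _).1 (Matrix.mem_specialOrthogonalGroup_iff.1 hY).1
  have hY'' := mul_eq_one_comm.1 hY'
  set R := Y * optical G X x m * Y.transpose with hR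
  have hRR : (R * R).trace = 0 := by
    have : R * R = Y * (optical G X x m * optical G X x m * Y.transpose) := by
      rw [hR]; simp only [Matrix.mul_assoc]
      rw [← Matrix.mul_assoc Y.transpose Y, hY'', Matrix.one_mul]
    rw [this, Matrix.trace_mul_comm, Matrix.mul_assoc, hY'', Matrix.mul_one]
    linarith
  -- Zero expansion removes the diagonal of the block. For the antisymmetric R that remains, tr R² =
  -- −tr R Rᵀ, so `hRR` forces R = 0.
  have hRt : R.transpose = -R := by
    rw [hYa, htr0]
    ext i j
    simp only [typeNOpticalBlock, Matrix.transpose_apply, Matrix.neg_apply, Matrix.of_apply]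
    split_ifs <;> first | omega | ring
  have hR0 : R = 0 := by
    rw [← Matrix.trace_mul_conjTranspose_self_eq_zero_iff,
      Matrix.conjTranspose_eq_transpose_of_trivial, hRt, Matrix.mul_neg, Matrix.trace_neg, hRR,
      neg_zero]
  have hρ : optical G X x m = 0 := by
    have : optical G X x m = Y.transpose * R * Y := by
      rw [hR]; simp only [Matrix.mul_assoc, hY'', Matrix.mul_one]
      rw [← Matrix.mul_assoc, hY'', Matrix.one_mul]
    rw [this, hR0]; simp
  let f : EuclideanSpace ℝ (Fin d) →ₗ[ℝ] ℝ :=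
    ((G x).flip v).toLinearMap ∘ₗ (covDerivOp (christoffelCLM G) X x).toLinearMap
  refine hf.perp_ext_zero (h.symm x hx) hd (by simp) f ?_ (fun i => ?_) hu
  · refine hf.perp_ext_zero (h.symm x hx) hd (by simp)
      (G x (covDerivOp (christoffelCLM G) X x (X x))).toLinearMap ?_ hκ hv
    exact (h.symm x hx _ _).trans (H.perp _)
  · refine hf.perp_ext_zero (h.symm x hx) hd (by simp)
      (G x (covDerivOp (christoffelCLM G) X x (m i))).toLinearMap ?_ (fun j => ?_) hv
    · exact (h.symm x hx _ _).trans (H.perp _)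
    · exact (h.symm x hx _ _).trans (congrFun (congrFun hρ j) i)

/-- At a point of the support of the Weyl tensor near which the expansion vanishes. -/
lemma optical_eq_zero (h : TypeNSpacetime G X Λ T) (hx : x ∈ T)
    (hcl : x ∈ closure {y | y ∈ T ∧ weylQ G Λ y ≠ 0})
    (htr : ∀ᶠ y in 𝓝 x, weylQ G Λ y ≠ 0 →
      ∃ n m, IsNullFrame (d := d) (G y) (X y) n m ∧ (optical G X y m).trace = 0)
    {u v : EuclideanSpace ℝ (Fin d)} (hu : G x (X x) u = 0) (hv : G x (X x) v = 0) :
    G x u (covDerivOp (christoffelCLM G) X x v) = 0 := by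
  obtain ⟨n, m, hf, -⟩ := h.frame x hx
  have hn : G x (X x) n ≠ 0 := by rw [hf.ell_n]; exact one_ne_zero
  -- Projecting along n extends u, v to nearby vectors orthogonal to X. The result at points of
  -- non-zero Weyl tensor then passes to the limit.
  have hc := h.continuousAt_optical_perpProj hx hn u v
  rw [ContinuousAt, perpProj_of_perp hu, perpProj_of_perp hv] at hc
  refine (isClosed_singleton (x := (0 : ℝ))).mem_of_frequently_of_tendsto ?_ hc
  refine ((mem_closure_iff_frequently.1 hcl).and_eventually (htr.eventually_nhds.and
    ((h.continuousAt_metric hx n).eventually_ne hn))).mono ?_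
  rintro y ⟨⟨hyT, hyQ⟩, hytr, hyn⟩
  rw [Set.mem_singleton_iff, h.symm y hyT]
  exact h.optical_eq_zero_of_weylQ_ne_zero hyT hyQ hytr (metric_perpProj hyn) (metric_perpProj hyn)

end TypeNSpacetime

end CoordMetric

/-! ### Limits of matrices in block form -/

section BlockLimit

variable {k : ℕ}

/-- The parameters are recovered from the first two entries of the first row, which turns the
existential into a closed equation. -/
lemma isClosed_typeNOpticalBlock (hk : 2 ≤ k) :
    IsClosed {N : Matrix (Fin k) (Fin k) ℝ | ∃ r a, N = typeNOpticalBlock k r a} := by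
  obtain ⟨k, rfl⟩ := Nat.exists_eq_add_of_le' hk
  have : {N : Matrix (Fin (k + 2)) (Fin (k + 2)) ℝ | ∃ r a, N = typeNOpticalBlock (k + 2) r a}
      = {N | N = typeNOpticalBlock (k + 2) (2 * N 0 0) (2 * N 0 1)} := by
    ext N
    refine ⟨?_, fun h => ⟨_, _, h⟩⟩
    rintro ⟨r, a, rfl⟩
    have e : ∀ z : ℝ, 2 * (z / 2) = z := fun z => by ring
    simp [typeNOpticalBlock, e]
  rw [this]
  refine isClosed_eq continuous_id (continuous_matrix fun i j => ?_)
  simp only [typeNOpticalBlock, Matrix.of_apply]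
  split_ifs <;> fun_prop

lemma smul_typeNOpticalBlock (c r a : ℝ) :
    c • typeNOpticalBlock k r a = typeNOpticalBlock k (c * r) (c * a) := by
  ext i j
  simp only [typeNOpticalBlock, Matrix.smul_apply, Matrix.of_apply, smul_eq_mul]
  split_ifs <;> ring

/-- If `ρ = W N Wᵀ` with `N` in normal form, and the Gram matrix `W Wᵀ` tends to `1`, then the limit
of `ρ` has a normal form. -/
lemma exists_normal_form_of_tendsto (hk : 2 ≤ k) {W R : ℕ → Matrix (Fin k) (Fin k) ℝ}
    {ρ : Matrix (Fin k) (Fin k) ℝ} (hW : Tendsto (fun s => W s * (W s).transpose) atTop (𝓝 1))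
    (hR : Tendsto R atTop (𝓝 ρ))
    (hN : ∀ᶠ s in atTop, ∃ r a, R s = W s * typeNOpticalBlock k r a * (W s).transpose) :
    ∃ X ∈ Matrix.specialOrthogonalGroup (Fin k) ℝ, ∃ a : ℝ,
      X * ρ * X.transpose = typeNOpticalBlock k ρ.trace a := by
  -- The diagonal of W Wᵀ tends to 1, so rows of W eventually have squared norm below 4 and entries
  -- in [−2, 2]. A subsequence of W converges to an orthogonal matrix.
  let S : Set (Matrix (Fin k) (Fin k) ℝ) :=
    Set.pi Set.univ fun _ => Set.pi Set.univ fun _ => Set.Icc (-2) 2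
  have hS : IsCompact S := isCompact_univ_pi fun _ => isCompact_univ_pi fun _ => isCompact_Icc
  have hWS : ∀ᶠ s in atTop, W s ∈ S := by
    have : ∀ i, ∀ᶠ s in atTop, (W s * (W s).transpose) i i < 4 := fun i => by
      have h1 : Tendsto (fun s => (W s * (W s).transpose) i i) atTop
          (𝓝 ((1 : Matrix (Fin k) (Fin k) ℝ) i i)) :=
        tendsto_pi_nhds.1 (tendsto_pi_nhds.1 hW i) i
      rw [Matrix.one_apply_eq] at h1
      exact h1.eventually_lt_const (by norm_num)
    filter_upwards [eventually_all.2 this] with s hs i _ j _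
    have h1 := hs i
    rw [Matrix.mul_apply] at h1
    have h2 : W s i j * W s i j ≤ ∑ j, W s i j * (W s).transpose j i :=
      Finset.single_le_sum (f := fun j => W s i j * W s i j) (fun j _ => mul_self_nonneg _)
        (Finset.mem_univ j)
    constructor <;> nlinarith
  have : FirstCountableTopology (Matrix (Fin k) (Fin k) ℝ) :=
    inferInstanceAs (FirstCountableTopology (Fin k → Fin k → ℝ))
  obtain ⟨V, -, φ, hφ, hV⟩ := hS.tendsto_subseq' hWS.frequently
  have hVt : Tendsto (fun s => (W (φ s)).transpose) atTop (𝓝 V.transpose) :=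
    (continuous_id.matrix_transpose.tendsto V).comp hV
  have hVV : V * V.transpose = 1 :=
    tendsto_nhds_unique (hV.mul hVt) (hW.comp hφ.tendsto_atTop)
  have hdet : V.det ^ 2 = 1 := by
    have := congrArg Matrix.det hVV
    rwa [Matrix.det_mul, Matrix.det_transpose, Matrix.det_one, ← sq] at this
  -- The adjugate replaces the inverse: conjugating by it gives det² times the block, which has
  -- block form again, and det² tends to 1.
  have hadj : Tendsto (fun s => (W (φ s)).adjugate) atTop (𝓝 V.adjugate) :=
    (continuous_id.matrix_adjugate.tendsto V).comp hV
  have hadjt : Tendsto (fun s => (W (φ s)).adjugate.transpose) atTop (𝓝 V.adjugate.transpose) :=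
    (continuous_id.matrix_transpose.tendsto V.adjugate).comp hadj
  have hlim := (hadj.mul (hR.comp hφ.tendsto_atTop)).mul hadjt
  obtain ⟨r, a, hra⟩ := (isClosed_typeNOpticalBlock hk).mem_of_tendsto hlim (by
    filter_upwards [hφ.tendsto_atTop.eventually hN] with s ⟨r, a, hs⟩
    refine ⟨(W (φ s)).det ^ 2 * r, (W (φ s)).det ^ 2 * a, ?_⟩
    rw [← smul_typeNOpticalBlock, Function.comp_apply, hs]
    have e1 : (W (φ s)).adjugate * W (φ s) = (W (φ s)).det • 1 := Matrix.adjugate_mul _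
    have e2 : (W (φ s)).transpose * (W (φ s)).adjugate.transpose = (W (φ s)).det • 1 := by
      rw [← Matrix.transpose_mul, e1, Matrix.transpose_smul, Matrix.transpose_one]
    calc _ = ((W (φ s)).adjugate * W (φ s)) * typeNOpticalBlock k r a
          * ((W (φ s)).transpose * (W (φ s)).adjugate.transpose) := by
            simp only [Matrix.mul_assoc]
      _ = _ := by
            rw [e1, e2]
            simp [smul_smul, sq])
  have hVadj : V.adjugate = V.det • V.transpose := by
    calc V.adjugate = V.adjugate * (V * V.transpose) := by rw [hVV, Matrix.mul_one]
      _ = _ := by rw [← Matrix.mul_assoc, Matrix.adjugate_mul, Matrix.smul_mul, Matrix.one_mul]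
  refine exists_special_of_orthogonal hk (X := V.transpose) (r := r) (a := a) ?_ ?_
  · rw [Matrix.mem_orthogonalGroup_iff, Matrix.transpose_transpose]
    exact mul_eq_one_comm.1 hVV
  · rw [← hra, hVadj]
    simp only [Matrix.transpose_smul, Matrix.smul_mul, Matrix.mul_smul, smul_smul]
    rw [← sq, hdet, one_smul]

end BlockLimit

/-! ### The normal form on the closure of the set of non-zero Weyl tensor -/

namespace CoordMetric

variable {d : ℕ} {G : EuclideanSpace ℝ (Fin d) →
      EuclideanSpace ℝ (Fin d) →L[ℝ] EuclideanSpace ℝ (Fin d) →L[ℝ] ℝ}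
  {X : EuclideanSpace ℝ (Fin d) → EuclideanSpace ℝ (Fin d)} {Λ : ℝ}
  {T : Set (EuclideanSpace ℝ (Fin d))} {x : EuclideanSpace ℝ (Fin d)}

namespace TypeNSpacetime

/-- The Gram matrix and the optical matrix of arbitrary vectors orthogonal to `X`, in terms of a
null frame in which the optical matrix is in normal form. -/
lemma exists_gram_optical (h : TypeNSpacetime G X Λ T) (hx : x ∈ T) (hQ : weylQ G Λ x ≠ 0)
    {v : Fin (d - 2) → EuclideanSpace ℝ (Fin d)} (hv : ∀ i, G x (X x) (v i) = 0) :
    ∃ (W : Matrix (Fin (d - 2)) (Fin (d - 2)) ℝ) (r a : ℝ),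
      W * W.transpose = Matrix.of (fun i j => G x (v i) (v j)) ∧
      optical G X x v = W * typeNOpticalBlock (d - 2) r a * W.transpose := by
  obtain ⟨n, m, hf, -⟩ := h.frame x hx
  obtain ⟨Y, hY, a, hYa⟩ := h.exists_normal_form hx hQ hf
  have hY' := (Matrix.mem_orthogonalGroup_iff _ _).1 (Matrix.mem_specialOrthogonalGroup_iff.1 hY).1
  have hY'' := mul_eq_one_comm.1 hY'
  have H := h.isTypeNOptical hx
  have hsym := h.symm x hx
  have hd : 2 ≤ d := by linarith [h.four_le]
  obtain ⟨Z, hZ⟩ : ∃ Z : Matrix (Fin (d - 2)) (Fin (d - 2)) ℝ, ∀ i j, Z i j = G x (v i) (m j) :=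
    ⟨Matrix.of fun i j => G x (v i) (m j), fun _ _ => rfl⟩
  have hexp : ∀ i, v i = G x (v i) n • X x + ∑ j, Z i j • m j := fun i => by
    have := hf.expand hsym hd (by simp) (v i)
    rw [hsym _ (X x), hv, zero_smul, add_zero] at this
    simpa only [hZ] using this
  have hgram : ∀ i j, G x (v i) (v j) = (Z * Z.transpose) i j := fun i j => by
    conv_lhs => rw [hexp j]
    simp only [map_add, map_smul, map_sum, hsym (v i) (X x), hv, smul_eq_mul, mul_zero, zero_add,
      Matrix.mul_apply, Matrix.transpose_apply, hZ]
    exact Finset.sum_congr rfl fun l _ => mul_comm _ _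
  have hκ := H.geodesic hQ hf hd (by simp)
  -- The X-components of the `v i` do not matter: in one slot because L takes values orthogonal to
  -- X, in the other because X is geodesic.
  have hopt : optical G X x v = optical G X x (fun i => ∑ j, Z i j • m j) := by
    ext i j
    simp only [optical, opticalOf, Matrix.of_apply]
    have hκ' : ∀ w, G x (X x) w = 0 → G x w (covDerivOp (christoffelCLM G) X x (X x)) = 0 :=
      fun w hw => by
        rw [hsym]
        exact hf.perp_ext_zero hsym hd (by simp)
          (G x (covDerivOp (christoffelCLM G) X x (X x))).toLinearMap
          ((hsym _ _).trans (H.perp _)) hκ hw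
    conv_lhs => rw [hexp j, map_add, map_smul, map_add, map_smul, hκ' _ (hv i), hexp i]
    simp [H.perp]
  refine ⟨Z * Y.transpose, (optical G X x m).trace, a, ?_, ?_⟩
  · ext i j
    rw [Matrix.of_apply, hgram, Matrix.transpose_mul, Matrix.transpose_transpose]
    have : Z * Y.transpose * (Y * Z.transpose) = Z * (Y.transpose * Y) * Z.transpose := by
      simp only [Matrix.mul_assoc]
    rw [this, hY'', Matrix.mul_one]
  · rw [hopt.trans (opticalOf_rotate m Z), ← hYa, Matrix.transpose_mul, Matrix.transpose_transpose]
    have : Z * Y.transpose * (Y * optical G X x m * Y.transpose) * (Y * Z.transpose)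
        = Z * (Y.transpose * Y) * optical G X x m * (Y.transpose * Y) * Z.transpose := by
      simp only [Matrix.mul_assoc]
    rw [this, hY'', Matrix.mul_one, Matrix.mul_one]

/-- The frame at x is projected to vectors orthogonal to X at nearby points of non-zero Weyl tensor.
These are orthonormal only in the limit, hence the version of the normal form with a Gram matrix
tending to 1. -/
lemma exists_normal_form_of_mem_closure (h : TypeNSpacetime G X Λ T) (hx : x ∈ T)
    (hcl : x ∈ closure {y | y ∈ T ∧ weylQ G Λ y ≠ 0})
    {n : EuclideanSpace ℝ (Fin d)} {m : Fin (d - 2) → EuclideanSpace ℝ (Fin d)}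
    (hf : IsNullFrame (G x) (X x) n m) :
    ∃ Y ∈ Matrix.specialOrthogonalGroup (Fin (d - 2)) ℝ, ∃ a : ℝ,
      Y * optical G X x m * Y.transpose
        = typeNOpticalBlock (d - 2) (optical G X x m).trace a := by
  obtain ⟨s, hs, hsx⟩ := mem_closure_iff_seq_limit.1 hcl
  have hn : G x (X x) n ≠ 0 := by rw [hf.ell_n]; exact one_ne_zero
  have hperp : ∀ i, perpProj G X n (m i) x = m i := fun i => perpProj_of_perp (hf.ell_m i)
  have hev : ∀ᶠ k in atTop, G (s k) (X (s k)) n ≠ 0 :=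
    hsx.eventually ((h.continuousAt_metric hx n).eventually_ne hn)
  have hex : ∀ k, ∃ W : Matrix (Fin (d - 2)) (Fin (d - 2)) ℝ, G (s k) (X (s k)) n ≠ 0 →
      ∃ r a, W * W.transpose = Matrix.of (fun i j =>
        G (s k) (perpProj G X n (m i) (s k)) (perpProj G X n (m j) (s k))) ∧
      optical G X (s k) (fun i => perpProj G X n (m i) (s k))
        = W * typeNOpticalBlock (d - 2) r a * W.transpose := fun k => by
    by_cases hk : G (s k) (X (s k)) n = 0
    -- A default value: by `hev`, this case occurs for only finitely many k.
    · exact ⟨0, fun h => absurd hk h⟩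
    · obtain ⟨W, r, a, h1, h2⟩ := h.exists_gram_optical (hs k).1 (hs k).2
        (v := fun i => perpProj G X n (m i) (s k)) (fun i => metric_perpProj hk)
      exact ⟨W, fun _ => ⟨r, a, h1, h2⟩⟩
  choose W hW using hex
  refine exists_normal_form_of_tendsto (by have := h.four_le; omega) (W := W)
    (R := fun k => optical G X (s k) (fun i => perpProj G X n (m i) (s k))) ?_ ?_ ?_
  · have : Tendsto (fun k => (Matrix.of fun i j =>
        G (s k) (perpProj G X n (m i) (s k)) (perpProj G X n (m j) (s k)) :
          Matrix (Fin (d - 2)) (Fin (d - 2)) ℝ)) atTop (𝓝 1) := by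
      refine tendsto_pi_nhds.2 fun i => tendsto_pi_nhds.2 fun j => ?_
      have hc : ContinuousAt
          (fun y => G y (perpProj G X n (m i) y) (perpProj G X n (m j) y)) x :=
        ((h.smooth_metric x hx).continuousAt.clm_apply (h.continuousAt_perpProj hx _ hn)).clm_apply
          (h.continuousAt_perpProj hx _ hn)
      have := hc.tendsto.comp hsx
      rw [hperp, hperp, hf.m_m] at this
      rw [Matrix.one_apply]
      exact this
    refine this.congr' ?_
    filter_upwards [hev] with k hk
    obtain ⟨r, a, h1, -⟩ := hW k hk
    exact h1.symm
  · refine tendsto_pi_nhds.2 fun i => tendsto_pi_nhds.2 fun j => ?_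
    have := (h.continuousAt_optical_perpProj hx hn (m i) (m j)).tendsto.comp hsx
    rw [hperp, hperp] at this
    exact this
  · filter_upwards [hev] with k hk
    obtain ⟨r, a, -, h2⟩ := hW k hk
    exact ⟨r, a, h2⟩

end TypeNSpacetime

end CoordMetric

/-! ### Passage from the manifold to a chart -/

namespace LorentzianMetric

variable {d : ℕ} {M : Type*} [TopologicalSpace M] [ChartedSpace (EuclideanSpace ℝ (Fin d)) M]
  {ℓ : ∀ p : M, TangentSpace (𝓡 d) p}
  {e : OpenPartialHomeomorph M (EuclideanSpace ℝ (Fin d))} {p : M}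

lemma mdifferentiable_of_mem_maximalAtlas (he : e ∈ IsManifold.maximalAtlas (𝓡 d) ∞ M) :
    e.MDifferentiable (𝓡 d) (𝓡 d) :=
  ⟨(contMDiffOn_of_mem_maximalAtlas he).mdifferentiableOn (by simp),
    (contMDiffOn_symm_of_mem_maximalAtlas he).mdifferentiableOn (by simp)⟩

lemma comps_surjective (he : e ∈ IsManifold.maximalAtlas (𝓡 d) ∞ M) (hp : p ∈ e.source) :
    Function.Surjective (comps e p) :=
  (mdifferentiable_of_mem_maximalAtlas he).mfderiv_surjective hp

/-- The components in the chart `e` of the vector field `ℓ`. -/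
noncomputable def fieldComps (e : OpenPartialHomeomorph M (EuclideanSpace ℝ (Fin d)))
    (ℓ : ∀ p : M, TangentSpace (𝓡 d) p) (x : EuclideanSpace ℝ (Fin d)) :
    EuclideanSpace ℝ (Fin d) := comps e (e.symm x) (ℓ (e.symm x))

lemma fieldComps_apply (hp : p ∈ e.source) : fieldComps e ℓ (e p) = comps e p (ℓ p) :=
  congrArg (fun q => comps e q (ℓ q)) (e.left_inv hp)

variable [IsManifold (𝓡 d) ∞ M] {g : LorentzianMetric d M}

lemma coord_comps (he : e ∈ IsManifold.maximalAtlas (𝓡 d) ∞ M) (hp : p ∈ e.source)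
    (u v : TangentSpace (𝓡 d) p) :
    g.coord e (e p) (comps e p u) (comps e p v) = g.val p u v := by
  have h := (mdifferentiable_of_mem_maximalAtlas he).symm_comp_deriv hp
  have hu : ∀ u : TangentSpace (𝓡 d) p,
      mfderiv (𝓡 d) (𝓡 d) e.symm (e p) (comps e p u) = u := fun u =>
    congrArg (fun A => A u) h
  -- The equality `e.symm (e p) = p` is not definitional. All tangent spaces are the same model
  -- space, so the metric can be transported by substitution.
  have key : ∀ q : M, q = p → ∀ u v : EuclideanSpace ℝ (Fin d),
      (g.val q : EuclideanSpace ℝ (Fin d) →L[ℝ] EuclideanSpace ℝ (Fin d) →L[ℝ] ℝ) u v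
        = g.val p u v := by
    rintro q rfl u v; rfl
  change g.val (e.symm (e p)) (mfderiv (𝓡 d) (𝓡 d) e.symm (e p) (comps e p u))
    (mfderiv (𝓡 d) (𝓡 d) e.symm (e p) (comps e p v)) = _
  rw [← key _ (e.left_inv hp) u v]
  exact congrArg₂ (fun a b : EuclideanSpace ℝ (Fin d) =>
    (g.val (e.symm (e p)) : EuclideanSpace ℝ (Fin d) →L[ℝ] EuclideanSpace ℝ (Fin d) →L[ℝ] ℝ) a b)
    (hu u) (hu v)

/-- The tangent map of the chart, composed with the smooth section ℓ ∘ e⁻¹, is a section of the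
tangent bundle of the model space with these components. -/
lemma contDiffOn_fieldComps (he : e ∈ IsManifold.maximalAtlas (𝓡 d) ∞ M)
    (hℓ : ContMDiff (𝓡 d) (𝓡 d).tangent ∞ (fun p => (⟨p, ℓ p⟩ : TangentBundle (𝓡 d) M))) :
    ContDiffOn ℝ ∞ (fieldComps e ℓ) e.target := by
  have : IsManifold (𝓡 d) 1 M := IsManifold.of_le (n := ∞) (by simp)
  have h1 := (contMDiffOn_of_mem_maximalAtlas he).contMDiffOn_tangentMapWithin (m := ∞)
    (by simp) e.open_source.uniqueMDiffOn
  have h2 := hℓ.comp_contMDiffOn (contMDiffOn_symm_of_mem_maximalAtlas he)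
  have h3 := h1.comp h2 (fun x hx => e.map_target hx)
  refine contMDiffOn_vectorSpace_iff_contDiffOn.1 (h3.congr fun x hx => ?_)
  simp only [Function.comp_apply, tangentMapWithin,
    mfderivWithin_of_isOpen e.open_source (e.map_target hx)]
  rw [e.right_inv hx]
  rfl

lemma contDiffOn_coord (he : e ∈ IsManifold.maximalAtlas (𝓡 d) ∞ M) :
    ContDiffOn ℝ ∞ (g.coord e) e.target := by
  have : IsManifold (𝓡 d) 1 M := IsManifold.of_le (n := ∞) (by simp)
  rw [contDiffOn_clm_apply]
  intro u
  rw [contDiffOn_clm_apply]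
  intro v
  have hs := contMDiffOn_symm_of_mem_maximalAtlas he
  have h1 := hs.contMDiffOn_tangentMapWithin (m := ∞) (by simp) e.open_target.uniqueMDiffOn
  have hV : ∀ u : EuclideanSpace ℝ (Fin d), ContMDiffOn (𝓡 d) (𝓡 d).tangent ∞
      (fun x => (⟨e.symm x, mfderiv (𝓡 d) (𝓡 d) e.symm x u⟩ : TangentBundle (𝓡 d) M))
      e.target := fun u => by
    have h2 : ContMDiffOn (𝓡 d) (𝓡 d).tangent ∞ (fun x : EuclideanSpace ℝ (Fin d) =>
        (⟨x, u⟩ : TangentBundle (𝓡 d) (EuclideanSpace ℝ (Fin d)))) e.target :=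
      contMDiffOn_vectorSpace_iff_contDiffOn.2 contDiffOn_const
    refine (h1.comp h2 fun x hx => hx).congr fun x hx => ?_
    simp only [Function.comp_apply, tangentMapWithin, mfderivWithin_of_isOpen e.open_target hx]
  rw [← contMDiffOn_iff_contDiffOn]
  intro x hx
  have : ContMDiffWithinAt (𝓡 d) ((𝓡 d).prod 𝓘(ℝ)) ∞
      (fun y => Bundle.TotalSpace.mk' ℝ (E := Bundle.Trivial M ℝ) (e.symm y)
        (g.val (e.symm y) (mfderiv (𝓡 d) (𝓡 d) e.symm y u)
          (mfderiv (𝓡 d) (𝓡 d) e.symm y v))) e.target x := by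
    apply ContMDiffWithinAt.clm_bundle_apply₂ (F₁ := EuclideanSpace ℝ (Fin d))
      (F₂ := EuclideanSpace ℝ (Fin d))
    · exact g.smooth.contMDiffAt.comp_contMDiffWithinAt x (hs x hx)
    · exact hV u x hx
    · exact hV v x hx
  simp only [Bundle.contMDiffWithinAt_totalSpace] at this
  exact this.2

lemma isNullFrame_comps (he : e ∈ IsManifold.maximalAtlas (𝓡 d) ∞ M) (hp : p ∈ e.source)
    {n : TangentSpace (𝓡 d) p} {m : Fin (d - 2) → TangentSpace (𝓡 d) p}
    (h : IsNullFrame (g.val p) (ℓ p) n m) :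
    IsNullFrame (g.coord e (e p)) (fieldComps e ℓ (e p)) (comps e p n)
      (fun i => comps e p (m i)) := by
  rw [fieldComps_apply hp]
  constructor <;> intros <;> rw [coord_comps he hp]
  · exact h.ell_ell
  · exact h.n_n
  · exact h.ell_n
  · exact h.ell_m _
  · exact h.n_m _
  · exact h.m_m _ _

lemma typeNSpacetime_coord (hd : 4 ≤ d) {Λ : ℝ} (hE : g.IsEinstein Λ)
    (hℓ : ContMDiff (𝓡 d) (𝓡 d).tangent ∞ (fun p => (⟨p, ℓ p⟩ : TangentBundle (𝓡 d) M)))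
    (hN : g.IsTypeNWAND ℓ) (he : e ∈ IsManifold.maximalAtlas (𝓡 d) ∞ M) :
    CoordMetric.TypeNSpacetime (g.coord e) (fieldComps e ℓ) Λ e.target where
  four_le := hd
  isOpen := e.open_target
  smooth_metric x hx := (contDiffOn_coord he).contDiffAt (e.open_target.mem_nhds hx)
  smooth_field x hx := (contDiffOn_fieldComps he hℓ).contDiffAt (e.open_target.mem_nhds hx)
  symm x hx a b := g.symm _ _ _
  einstein x hx v w := by
    obtain ⟨p, hp, rfl⟩ : ∃ p ∈ e.source, e p = x := ⟨_, e.map_target hx, e.right_inv hx⟩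
    obtain ⟨v, rfl⟩ := comps_surjective he hp v
    obtain ⟨w, rfl⟩ := comps_surjective he hp w
    rw [coord_comps he hp]
    exact hE e he p hp v w
  frame x hx := by
    obtain ⟨p, hp, rfl⟩ : ∃ p ∈ e.source, e p = x := ⟨_, e.map_target hx, e.right_inv hx⟩
    obtain ⟨n, m, hf, hw⟩ := hN e he p hp
    refine ⟨_, _, isNullFrame_comps he hp hf, ?_⟩
    rw [fieldComps_apply hp]
    exact ⟨hw.C0i0j, hw.C0ijk, hw.C010i, hw.Cijkl, hw.C0i1j, hw.C01ij, hw.C0101, hw.C1ijk,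
      hw.C101i⟩

lemma opticalMatrix_eq (p : M) (m : Fin (d - 2) → TangentSpace (𝓡 d) p) :
    g.opticalMatrix e ℓ p m
      = CoordMetric.optical (g.coord e) (fieldComps e ℓ) (e p) (fun i => comps e p (m i)) := by
  ext i j
  change g.coord e (e p) (comps e p (m i))
    (CoordMetric.covDeriv (g.coord e) (fieldComps e ℓ) (e p) (comps e p (m j))) = _
  rw [CoordMetric.covDeriv_eq_covDerivOp]
  rfl

end LorentzianMetric

end

/-! ### The theorem in each chart -/

open LorentzianMetric Filter Topology in
theorem mainTheorem2 {d : ℕ} (hd : 4 ≤ d) {M : Type*} [TopologicalSpace M]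
    [ChartedSpace (EuclideanSpace ℝ (Fin d)) M] [IsManifold (𝓡 d) ∞ M]
    (g : LorentzianMetric d M) (Λ : ℝ) (hE : g.IsEinstein Λ)
    (ℓ : ∀ p : M, TangentSpace (𝓡 d) p)
    (hℓ : ContMDiff (𝓡 d) (𝓡 d).tangent ∞
      (fun p => (⟨p, ℓ p⟩ : TangentBundle (𝓡 d) M)))
    (hN : g.IsTypeNWAND ℓ) :
    ∀ e ∈ IsManifold.maximalAtlas (𝓡 d) ∞ M,
      (∀ p ∈ g.weylSupport e,
        ∀ (n : TangentSpace (𝓡 d) p) (m : Fin (d - 2) → TangentSpace (𝓡 d) p),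
          IsNullFrame (g.val p) (ℓ p) n m →
          ∃ X ∈ Matrix.specialOrthogonalGroup (Fin (d - 2)) ℝ, ∃ a : ℝ,
            g.opticalMatrix e ℓ p (fun i => ∑ j, X i j • m j) =
              typeNOpticalBlock (d - 2) (g.opticalMatrix e ℓ p m).trace a) ∧
      (∀ U : Set M, IsOpen U →
        (∀ p ∈ U ∩ g.weylSupport e,
          ∃ (n : TangentSpace (𝓡 d) p) (m : Fin (d - 2) → TangentSpace (𝓡 d) p),
            IsNullFrame (g.val p) (ℓ p) n m ∧ (g.opticalMatrix e ℓ p m).trace = 0) →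
        ∀ p ∈ U ∩ g.weylSupport e,
          ∀ (n : TangentSpace (𝓡 d) p) (m : Fin (d - 2) → TangentSpace (𝓡 d) p),
            IsNullFrame (g.val p) (ℓ p) n m →
            g.kappa e ℓ p m = 0 ∧ g.opticalMatrix e ℓ p m = 0) := by
  intro e he
  have h := typeNSpacetime_coord hd hE hℓ hN he
  have hcl : ∀ p ∈ g.weylSupport e, e p ∈ closure
      {y | y ∈ e.target ∧ CoordMetric.weylQ (g.coord e) Λ y ≠ 0} := by
    rintro p ⟨hp, hpc⟩
    rw [mem_closure_iff_frequently] at hpc ⊢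
    refine (e.continuousAt hp).tendsto.frequently (hpc.mono ?_)
    rintro q ⟨hq, a, b, c, f, hne⟩
    refine ⟨e.map_source hq, fun h0 => hne ?_⟩
    change CoordMetric.weyl (g.coord e) (e q) _ _ _ _ = 0
    rw [← h.weylQ_eq (e.map_source hq), h0]
    rfl
  refine ⟨fun p hp n m hf => ?_, fun U hU htr p hp n m hf => ?_⟩
  · obtain ⟨Y, hY, a, hYa⟩ := h.exists_normal_form_of_mem_closure (e.map_source hp.1) (hcl p hp)
      (isNullFrame_comps he hp.1 hf)
    refine ⟨Y, hY, a, ?_⟩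
    rw [opticalMatrix_eq, opticalMatrix_eq, ← hYa, ← opticalOf_rotate]
    congr 1
    ext1 i
    simp only [comps, map_sum, map_smul]
    rfl
  · have hx := e.map_source hp.2.1
    have hF := isNullFrame_comps he hp.2.1 hf
    -- Points near p lie in U, and those with non-zero Weyl tensor lie in the support, so the
    -- expansion hypothesis covers them.
    have htr' : ∀ᶠ y in 𝓝 (e p), CoordMetric.weylQ (g.coord e) Λ y ≠ 0 →
        ∃ n m, IsNullFrame (d := d) (g.coord e y) (fieldComps e ℓ y) n m ∧
          (CoordMetric.optical (g.coord e) (fieldComps e ℓ) y m).trace = 0 := by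
      have hU' : ∀ᶠ y in 𝓝 (e p), e.symm y ∈ U :=
        (e.continuousAt_symm hx).eventually_mem (hU.mem_nhds (by
          rw [e.left_inv hp.2.1]; exact hp.1))
      filter_upwards [hU', e.open_target.mem_nhds hx] with y hyU hyT hyQ
      obtain ⟨q, hq, rfl⟩ : ∃ p ∈ e.source, e p = y := ⟨_, e.map_target hyT, e.right_inv hyT⟩
      rw [e.left_inv hq] at hyU
      have hqS : q ∈ g.weylSupport e := by
        refine ⟨hq, subset_closure ⟨hq, ?_⟩⟩
        by_contra! hc
        apply hyQ
        ext c f b a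
        obtain ⟨a, rfl⟩ := comps_surjective he hq a
        obtain ⟨b, rfl⟩ := comps_surjective he hq b
        obtain ⟨c, rfl⟩ := comps_surjective he hq c
        obtain ⟨f, rfl⟩ := comps_surjective he hq f
        rw [h.weylQ_eq hyT]
        exact hc a b c f
      obtain ⟨n, m, hf, h0⟩ := htr q ⟨hyU, hqS⟩
      refine ⟨_, _, isNullFrame_comps he hq hf, ?_⟩
      rw [← opticalMatrix_eq, h0]
    -- Both κ and ρ are values of g(u, ∇_v ℓ) with u, v orthogonal to ℓ; κ is the case v = ℓ.
    have key := fun u v => h.optical_eq_zero hx (hcl p hp.2) htr' (u := u) (v := v)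
    constructor
    · ext i
      change g.coord e (e p) (comps e p (m i))
        (CoordMetric.covDeriv (g.coord e) (fieldComps e ℓ) (e p) (comps e p (ℓ p))) = 0
      rw [CoordMetric.covDeriv_eq_covDerivOp, ← fieldComps_apply hp.2.1]
      exact key _ _ (hF.ell_m i) hF.ell_ell
    · rw [opticalMatrix_eq]
      ext i j
      exact key _ _ (hF.ell_m i) (hF.ell_m j)
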